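/- Notation. For a real symmetric matrix $A\in\mathbb R^{n\times n}$ let $\lambda_1(A)\ge\dots\ge\lambda_n(A)$ be its eigenvalues with multiplicity, and put $\lambda_{n+1}(A):=0$. Let $\|A\|$, $\|A\|_F$, $\|A\|_*$ be the spectral, Frobenius and nuclear norms, and $r(A)=\|A\|_*/\|A\|$ the effective rank. A best rank-$L$ approximation of $A$ is a minimizer of $\|A-C\|_F$ over all $C$ with $\operatorname{rank} C\le L$; it is denoted $A_L$, and the result holds for every choice of the minimizers. Write $x_+=\max\{x,0\}$ and $c_N=\frac{N-1}{2N-1}$. For $N\ge 2$, $\eta>0$, $\alpha>0$ define $$T_N^+(\lambda,\mu,\alpha)=\int_\alpha^{\mu}\frac{dy}{y^{N-1}(\lambda-y^N)},$$ $$T_N^{\mathrm{Id}}(\lambda,\varepsilon,\alpha,\eta)=\tfrac1\eta T_N^+\big(\lambda,(c_N\lambda)^{1/N},\alpha\big)+\left\lceil\Big(\tfrac{(c_N\lambda)^{1/N}}{\alpha}\Big)^{N-1}\right\rceil+\frac{\ln(\lambda^{1/N}/\varepsilon)-|\ln(1-c_N^{1/N})|}{\big|\ln\big(1-\eta N(c_N\lambda)^{2-2/N}\big)\big|}\quad(\alpha^N<c_N\lambda),$$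 $$T_0(\{\lambda_\ell\}_{\ell=1}^L,\varepsilon,\alpha,\eta)=\max\Big\{T_N^{\mathrm{Id}}\big(\lambda_1,\tfrac{\lambda_1}{2},\alpha,\eta\big),\ \max_{1\le\ell\le L}T_N^{\mathrm{Id}}\big(\lambda_\ell,\tfrac{\lambda_\ell^{1/N}}{4N}\varepsilon,\alpha,\eta\big)\Big\},$$ $$T_1(\lambda,\varepsilon',\alpha,\eta)=\tfrac1\eta T_N^+\big(\lambda,(\varepsilon'\lambda)^{1/N},\alpha\big)\quad(\alpha^N<\lambda).$$ For $N=2$ these are $$T_2^{\mathrm{Id}}(\lambda,\varepsilon,\alpha,\eta)=\tfrac{1}{2\eta\lambda}\big[\ln(\tfrac{\lambda}{\alpha^2}-1)-\ln2\big]+\Big\lceil\sqrt{\tfrac\lambda3}\tfrac1\alpha\Big\rceil+\frac{\ln(\sqrt\lambda/\varepsilon)-|\ln(1-\sqrt{1/3})|}{|\ln(1-2\eta\lambda/3)|},$$ $$T_1(\lambda,\varepsilon',\alpha,\eta)=\tfrac1{2\eta\lambda}\big[\ln(\tfrac{\lambda}{\alpha^2}-1)-\ln(\tfrac1{\varepsilon'}-1)\big].$$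 Theorem. Let $N\ge2$, $n\ge2$ and $1\le L\le n$. Let $\widehat W\in\mathbb R^{n\times n}$ be symmetric with eigenvalues $\lambda_1>\lambda_2>\dots>\lambda_n\ge0$, and let $\delta_s=\min_{i\ne j}|\lambda_i-\lambda_j|>0$. Let $E\in\mathbb R^{n\times n}$ be symmetric and let $\widetilde W=\widehat W+E$ have eigenvalues $\widetilde\lambda_1\ge\dots\ge\widetilde\lambda_n$. Let $\widetilde W^+$ be a symmetric matrix with eigenvalues $(\widetilde\lambda_1)_+,\dots,(\widetilde\lambda_n)_+$. Let $W_1(k),\dots,W_N(k)$ be the gradient descent iterates $$W_j(0)=\alpha I,\qquad W_j(k+1)=W_j(k)-\eta\,\nabla_{W_j}\widetilde{\mathcal L}\big(W_1(k),\dots,W_N(k)\big),\qquad \widetilde{\mathcal L}(W_1,\dots,W_N)=\tfrac12\|W_N\cdots W_1-\widetilde W\|_F^2,$$ and $W(k)=W_N(k)\cdots W_1(k)$. Assume $(\widetilde\lambda_L)_+>0$, $\varepsilon\in(0,1)$, $\varepsilon'\in(0,c_N)$, $\alpha>0$, $\alpha^N<\varepsilon'(\widetilde\lambda_L)_+$ and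 $$0<\eta<\frac1{(3N-2)\max\{\alpha^{N-2},\|\widetilde W\|^{2-2/N}\}} .$$ Put $L'=\max\{\ell\in\{1,\dots,n\}:\varepsilon'(\widetilde\lambda_\ell)_+>\alpha^N\}$, $\widetilde T_0=T_0(\{(\widetilde\lambda_\ell)_+\}_{\ell=1}^L,\varepsilon,\alpha,\eta)$ and $\widetilde T_1=T_1((\widetilde\lambda_{L+1})_+,\varepsilon',\alpha,\eta)$, where $\widetilde T_1:=+\infty$ if $(\widetilde\lambda_{L+1})_+\le\alpha^N$. Then for every integer $k\ge 0$ with $\widetilde T_0\le k\le\widetilde T_1$, $$\big|r(\widehat W_L)-r(W(k))\big|\le 2L\frac{\|E\|}{\lambda_1}+\varepsilon\,r(\widetilde W^+_L)+\frac{2(L'-L)}{c_N}\frac{(\widetilde\lambda_{L+1})_+}{(\widetilde\lambda_1)_+}\varepsilon'+(n-L')\frac{2\alpha^N}{\varepsilon'(\widetilde\lambda_1)_+}$$ and $$\big\|W(k)_L-\widehat W_L\big\|_F<\Big(\frac{4\sqrt{2L}}{\delta_s}\lambda_1+\sqrt L\Big)\|E\|+\frac{\varepsilon\sqrt L\,(\lambda_1+\|E\|)}{4}.$$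 -/

import Mathlib

/-! ## Matrices: eigenvalues, norms, best low-rank approximation, effective rank -/

/-- The eigenvalues of a symmetric matrix, with multiplicity, in decreasing order and indexed from
`1` as in `λ₁ ≥ λ₂ ≥ ⋯ ≥ λₙ`. By convention the value is `0` for an index outside `{1, …, n}`. -/
noncomputable def eig {n : ℕ} {A : Matrix (Fin n) (Fin n) ℝ} (hA : A.IsHermitian) (i : ℕ) : ℝ :=
  if h : 1 ≤ i ∧ i ≤ n then
    hA.eigenvalues₀ ⟨i - 1, by rw [Fintype.card_fin]; omega⟩
  else 0

/-- The spectral norm `‖A‖`: the operator norm for the Euclidean norm on `ℝⁿ`. -/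
noncomputable def specNorm {n : ℕ} (A : Matrix (Fin n) (Fin n) ℝ) : ℝ :=
  ‖Matrix.toEuclideanCLM (n := Fin n) (𝕜 := ℝ) A‖

/-- The Frobenius norm. -/
noncomputable def frobNorm {n : ℕ} (A : Matrix (Fin n) (Fin n) ℝ) : ℝ :=
  Real.sqrt (∑ i, ∑ j, A i j ^ 2)

/-- The nuclear norm: the sum of the singular values. -/
noncomputable def nuclearNorm {n : ℕ} (A : Matrix (Fin n) (Fin n) ℝ) : ℝ :=
  ∑ i ∈ Finset.range n, (Matrix.toEuclideanLin (𝕜 := ℝ) A).singularValues i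

/-- The effective rank `r(A) = ‖A‖_* / ‖A‖`. -/
noncomputable def effRank {n : ℕ} (A : Matrix (Fin n) (Fin n) ℝ) : ℝ :=
  nuclearNorm A / specNorm A

/-- `B` is a best rank-`L` approximation of `A`: it has rank at most `L` and minimizes the Frobenius
distance to `A` among all matrices of rank at most `L`. -/
def IsBestRankApprox {n : ℕ} (L : ℕ) (A B : Matrix (Fin n) (Fin n) ℝ) : Prop :=
  B.rank ≤ L ∧
    ∀ C : Matrix (Fin n) (Fin n) ℝ, C.rank ≤ L → frobNorm (A - B) ≤ frobNorm (A - C)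

/-- The minimal eigengap `min_{i ≠ j} |λ_i - λ_j|` of a symmetric matrix of size `n ≥ 2`. -/
noncomputable def eigengap {n : ℕ} {A : Matrix (Fin n) (Fin n) ℝ} (hA : A.IsHermitian) : ℝ :=
  sInf {x : ℝ | ∃ i j : ℕ, (1 ≤ i ∧ i ≤ n) ∧ (1 ≤ j ∧ j ≤ n) ∧ i ≠ j ∧
    x = |eig hA i - eig hA j|}

/-! ## Gradient descent for deep matrix factorization -/

/-- The product `W_N ⋯ W_2 W_1`; the factor `W_{j+1}` is stored at the index `j : Fin N`. -/
def layerProd {n N : ℕ} (W : Fin N → Matrix (Fin n) (Fin n) ℝ) : Matrix (Fin n) (Fin n) ℝ :=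
  (List.ofFn fun j : Fin N => W j.rev).prod

/-- The loss `½ ‖W_N ⋯ W_1 - M‖_F²` for the target matrix `M`. -/
noncomputable def loss {n N : ℕ} (M : Matrix (Fin n) (Fin n) ℝ)
    (W : Fin N → Matrix (Fin n) (Fin n) ℝ) : ℝ :=
  1 / 2 * frobNorm (layerProd W - M) ^ 2

/-- The gradient `∇_{W_j}` of the loss with respect to the `j`-th factor: the matrix of the partial
derivatives with respect to the entries of `W_j`. -/
noncomputable def lossGrad {n N : ℕ} (M : Matrix (Fin n) (Fin n) ℝ)
    (W : Fin N → Matrix (Fin n) (Fin n) ℝ) (j : Fin N) : Matrix (Fin n) (Fin n) ℝ :=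
  Matrix.of fun a b =>
    deriv (fun t : ℝ => loss M (Function.update W j (W j + t • Matrix.single a b (1 : ℝ)))) 0

/-- The gradient descent iterates `(W_1(k), …, W_N(k))` with constant step size `η` and identical
initialization `W_j(0) = α I`. -/
noncomputable def gdIter {n N : ℕ} (M : Matrix (Fin n) (Fin n) ℝ) (η α : ℝ) :
    ℕ → Fin N → Matrix (Fin n) (Fin n) ℝ
  | 0 => fun _ => α • (1 : Matrix (Fin n) (Fin n) ℝ)
  | k + 1 => fun j => gdIter M η α k j - η • lossGrad M (gdIter M η α k) j

/-- The end-to-end iterate `W(k) = W_N(k) ⋯ W_1(k)`. -/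
noncomputable def gdProd {n : ℕ} (N : ℕ) (M : Matrix (Fin n) (Fin n) ℝ) (η α : ℝ) (k : ℕ) :
    Matrix (Fin n) (Fin n) ℝ :=
  layerProd (gdIter (N := N) M η α k)

/-! ## The time window -/

/-- The constant `c_N = (N - 1) / (2N - 1)`. -/
noncomputable def cN (N : ℕ) : ℝ := ((N : ℝ) - 1) / (2 * (N : ℝ) - 1)

/-- `T_N⁺(lam, μ, α)`: the time that the scalar gradient flow `y' = y^(N-1) (lam - y^N)` needs to
grow from `α` to `μ`, where `0 < α ≤ μ` and `μ ^ N < lam`. -/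
noncomputable def flowTime (N : ℕ) (lam μ α : ℝ) : ℝ :=
  ∫ y in α..μ, 1 / (y ^ (N - 1) * (lam - y ^ N))

/-- `T_N^Id(lam, ε, α, η)`, where `0 < α` and `α ^ N < c_N * lam`: the number of gradient descent
steps that are allowed for reaching the accuracy `ε` for an eigenvalue `lam`. -/
noncomputable def TId (N : ℕ) (lam ε α η : ℝ) : ℝ :=
  1 / η * flowTime N lam ((cN N * lam) ^ (1 / (N : ℝ))) α
    + (⌈((cN N * lam) ^ (1 / (N : ℝ)) / α) ^ (N - 1)⌉ : ℝ)
    + (Real.log (lam ^ (1 / (N : ℝ)) / ε) - |Real.log (1 - cN N ^ (1 / (N : ℝ)))|)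
        / |Real.log (1 - η * N * (cN N * lam) ^ (2 - 2 / (N : ℝ)))|

/-- The left end `T₀({lam_ℓ}_{ℓ ≤ L}, ε, α, η)` of the window; `lam` is indexed from `1`. -/
noncomputable def Tzero (N L : ℕ) (lam : ℕ → ℝ) (ε α η : ℝ) : ℝ :=
  max (TId N (lam 1) (lam 1 / 2) α η)
    (sSup ((fun l : ℕ => TId N (lam l) (lam l ^ (1 / (N : ℝ)) / (4 * N) * ε) α η) '' Set.Icc 1 L))

/-- The right end `T₁(lam, ε', α, η)` of the window, where `0 < α` and `α ^ N < lam`: `1 / η` times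
the time that the scalar gradient flow needs from `α` to `(ε' * lam) ^ (1 / N)`. -/
noncomputable def Tone (N : ℕ) (lam ε' α η : ℝ) : ℝ :=
  1 / η * flowTime N lam ((ε' * lam) ^ (1 / (N : ℝ))) α

/-- `L' = max {ℓ ∈ {1, …, n} : α ^ N < ε' * lam_ℓ}`. -/
noncomputable def Lprime (n N : ℕ) (lam : ℕ → ℝ) (ε' α : ℝ) : ℕ :=
  sSup {l : ℕ | (1 ≤ l ∧ l ≤ n) ∧ α ^ N < ε' * lam l}

/-! ### The closed forms for `N = 2` -/

theorem flowTime_two {lam μ α : ℝ} (hα : 0 < α) (hμ : 0 < μ) (hα' : α ^ 2 < lam)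
    (hμ' : μ ^ 2 < lam) :
    flowTime 2 lam μ α =
      1 / (2 * lam) * (Real.log (lam / α ^ 2 - 1) - Real.log (lam / μ ^ 2 - 1)) := by
  have hl : 0 < lam := lt_trans (by positivity) hα'
  have key : ∀ y ∈ Set.uIcc α μ, 0 < y ∧ 0 < lam - y ^ 2 := by
    intro y hy
    rw [Set.mem_uIcc] at hy
    rcases hy with h | h
    · exact ⟨by linarith [h.1], by nlinarith [h.1, h.2]⟩
    · exact ⟨by linarith [h.1], by nlinarith [h.1, h.2]⟩
  have hd : ∀ y ∈ Set.uIcc α μ, HasDerivAt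
      (fun y : ℝ => 1 / (2 * lam) * (Real.log (y ^ 2) - Real.log (lam - y ^ 2)))
      (1 / (y ^ (2 - 1) * (lam - y ^ 2))) y := by
    intro y hy
    obtain ⟨h1, h2⟩ := key y hy
    have e1 := (hasDerivAt_pow 2 y).log (by positivity)
    have e2 := ((hasDerivAt_pow 2 y).const_sub lam).log h2.ne'
    have h3 := h2.ne'
    have e3 : 1 / (2 * lam) * (((2 : ℕ) : ℝ) * y ^ (2 - 1) / y ^ 2
        - -(((2 : ℕ) : ℝ) * y ^ (2 - 1)) / (lam - y ^ 2)) = 1 / (y ^ (2 - 1) * (lam - y ^ 2)) := by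
      simp only [Nat.cast_ofNat, Nat.add_one_sub_one, pow_one]
      field_simp
      ring
    exact e3 ▸ (e1.sub e2).const_mul (1 / (2 * lam))
  have hc : ContinuousOn (fun y : ℝ => 1 / (y ^ (2 - 1) * (lam - y ^ 2))) (Set.uIcc α μ) := by
    apply ContinuousOn.div continuousOn_const (by fun_prop)
    intro y hy
    obtain ⟨h1, h2⟩ := key y hy
    positivity
  unfold flowTime
  rw [intervalIntegral.integral_eq_sub_of_hasDerivAt hd hc.intervalIntegrable]
  have a1 : lam / α ^ 2 - 1 = (lam - α ^ 2) / α ^ 2 := by field_simp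
  have a2 : lam / μ ^ 2 - 1 = (lam - μ ^ 2) / μ ^ 2 := by field_simp
  rw [a1, a2, Real.log_div (by linarith) (by positivity), Real.log_div (by linarith) (by positivity)]
  ring

theorem Tone_two {lam ε' α η : ℝ} (hα : 0 < α) (hα' : α ^ 2 < lam) (h0 : 0 < ε') (h1 : ε' < 1) :
    Tone 2 lam ε' α η =
      1 / (2 * η * lam) * (Real.log (lam / α ^ 2 - 1) - Real.log (1 / ε' - 1)) := by
  have hl : 0 < lam := lt_trans (by positivity) hα'
  have hs : ((ε' * lam) ^ (1 / ((2 : ℕ) : ℝ))) = Real.sqrt (ε' * lam) := by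
    rw [Real.sqrt_eq_rpow]; norm_num
  have hq : Real.sqrt (ε' * lam) ^ 2 = ε' * lam := Real.sq_sqrt (by positivity)
  have hb : lam / (ε' * lam) = 1 / ε' := by field_simp
  unfold Tone
  rw [hs, flowTime_two hα (by positivity) hα' (by rw [hq]; nlinarith), hq, hb]
  ring

theorem TId_two {lam ε α η : ℝ} (hα : 0 < α) (hα' : α ^ 2 < lam) :
    TId 2 lam ε α η =
      1 / (2 * η * lam) * (Real.log (lam / α ^ 2 - 1) - Real.log 2)
        + (⌈Real.sqrt (lam / 3) * (1 / α)⌉ : ℝ)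
        + (Real.log (Real.sqrt lam / ε) - |Real.log (1 - Real.sqrt (1 / 3))|)
          / |Real.log (1 - 2 * η * lam / 3)| := by
  have hl : 0 < lam := lt_trans (by positivity) hα'
  have hc : cN 2 = 1 / 3 := by unfold cN; norm_num
  have hs : ∀ x : ℝ, x ^ (1 / ((2 : ℕ) : ℝ)) = Real.sqrt x := by
    intro x; rw [Real.sqrt_eq_rpow]; norm_num
  have hm : 1 / 3 * lam = lam / 3 := by ring
  have hq : Real.sqrt (lam / 3) ^ 2 = lam / 3 := Real.sq_sqrt (by positivity)
  have hb : lam / (lam / 3) - 1 = 2 := by field_simp; norm_num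
  have hp : (lam / 3) ^ (2 - 2 / ((2 : ℕ) : ℝ)) = lam / 3 := by norm_num
  have he : 1 - η * ((2 : ℕ) : ℝ) * (lam / 3) = 1 - 2 * η * lam / 3 := by push_cast; ring
  have hr : (Real.sqrt (lam / 3) / α) ^ (2 - 1) = Real.sqrt (lam / 3) * (1 / α) := by
    norm_num; ring
  unfold TId
  rw [hc, hs, hs, hs, hm, flowTime_two hα (by positivity) hα' (by rw [hq]; linarith), hq, hb, hp,
    he, hr]
  ring

/-! ## Scalar gradient descent -/

/-! Since all factors start at `α • 1`, they remain equal and diagonal in a fixed eigenbasis of the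
noisy target (`gdIter_eq`). Gradient descent thus splits into the scalar recursions `x ↦ x - η
x^(N-1) (x^N - τ)`, one for each noisy eigenvalue `τ`, and the product iterate has eigenvalues `q i
= x_i(k)^N`.

The step-size condition makes the scalar step increasing in both `x` and `τ` (`gdStep_mono`). Hence
iterates remain in an invariant interval, increase towards their limit when they start below it, and
keep the order of the eigenvalues. Up to the level `y^N = c_N τ` the field is increasing, so the
Euler scheme lags behind its flow (`euler_le_of_le_integral`), and the lag telescopes to a
controlled number of steps (`euler_time_le`). The first fact keeps the trailing eigenvalues below
`ε' * lamP (L + 1)` up to `T₁`, apart from the floor `α^N` set by the initialization. The second,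
followed by linear convergence above that level, brings each of the first `L` values of `q` within
relative error `ε / 4` after `T₀`.

For the effective rank, the truncated positive spectrum `p` is put between the truncated spectrum of
`What` and `q`: Weyl's inequality controls one difference and the window estimates the other. The
best approximation of `Wplus` need not be unique, but every choice has the same trace, which
suffices to bound its effective rank from below (`IsBestRankApprox.le_effRank`). For the Frobenius
bound, both `What` and the iterate have a gap after index `L`, so their best approximations are
spectral truncations. The truncation of the noisy target lies between them, and a `sin Θ` estimate
(`frobNorm_truncation_sub_le`) compares it with that of `What`. -/

theorem pow_sub_pow_le_mul {x y b : ℝ} (hx : 0 ≤ x) (hxy : x ≤ y) (hy : y ≤ b) (n : ℕ) :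
    y ^ (n + 1) - x ^ (n + 1) ≤ (n + 1) * b ^ n * (y - x) := by
  induction n with
  | zero => simp
  | succ n ih =>
    have hb : 0 ≤ b := by linarith
    have h1 : y ^ (n + 1 + 1) - x ^ (n + 1 + 1)
        = y * (y ^ (n + 1) - x ^ (n + 1)) + x ^ (n + 1) * (y - x) := by ring
    have h2 : y * (y ^ (n + 1) - x ^ (n + 1)) ≤ b * ((n + 1) * b ^ n * (y - x)) := by
      apply mul_le_mul hy ih _ hb
      exact sub_nonneg.2 (pow_le_pow_left₀ hx hxy _)
    have h3 : x ^ (n + 1) * (y - x) ≤ b ^ (n + 1) * (y - x) :=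
      mul_le_mul_of_nonneg_right (pow_le_pow_left₀ hx (hxy.trans hy) _) (sub_nonneg.2 hxy)
    rw [h1]
    push_cast
    calc _ ≤ b * ((n + 1) * b ^ n * (y - x)) + b ^ (n + 1) * (y - x) := add_le_add h2 h3
      _ = _ := by ring

/-- One gradient descent step for the loss `(x ^ N - lam) ^ 2 / (2 N)`. -/
def gdStep (N : ℕ) (η lam x : ℝ) : ℝ := x - η * (x ^ (N - 1) * (x ^ N - lam))

/-- Scalar gradient descent started at `α`. -/
def gdScalar (N : ℕ) (η lam α : ℝ) : ℕ → ℝ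
  | 0 => α
  | k + 1 => gdStep N η lam (gdScalar N η lam α k)

theorem gdStep_fixed (N : ℕ) (η s : ℝ) : gdStep N η (s ^ N) s = s := by simp [gdStep]

section Step

variable {N : ℕ} {η b : ℝ}

/-- The derivative of `x^(2N-1) - lam x^(N-1)` on `[0, b]` is at most `(2N-1) b^(2N-2) + (N-1) b^N
b^(N-2) = (3N-2) b^(2N-2)` when `lam ≥ -b^N`; this is the source of the constant in the step size.
The second summand accounts for negative noisy eigenvalues. -/
theorem gdStep_mono (hN : 2 ≤ N) (hη : 0 ≤ η) (hb : η * (3 * N - 2) * b ^ (2 * N - 2) ≤ 1)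
    {lam lam' x y : ℝ} (hl : lam ≤ lam') (hlb : -b ^ N ≤ lam) (hx : 0 ≤ x)
    (hxy : x ≤ y) (hy : y ≤ b) : gdStep N η lam x ≤ gdStep N η lam' y := by
  obtain ⟨m, rfl⟩ : ∃ m, N = m + 2 := ⟨N - 2, by omega⟩
  have hb0 : 0 ≤ b := by linarith
  have hd : 0 ≤ y - x := sub_nonneg.2 hxy
  have e1 : m + 2 - 1 = m + 1 := by omega
  have e2 : 2 * (m + 2) - 2 = 2 * m + 2 := by omega
  rw [e2] at hb
  unfold gdStep
  rw [e1]
  have h1 := pow_sub_pow_le_mul hx hxy hy m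
  have h2 := pow_sub_pow_le_mul hx hxy hy (2 * m + 2)
  have h3 : 0 ≤ y ^ (m + 1) - x ^ (m + 1) := sub_nonneg.2 (pow_le_pow_left₀ hx hxy _)
  have h4 : (lam' - lam) * y ^ (m + 1) ≥ 0 :=
    mul_nonneg (sub_nonneg.2 hl) (pow_nonneg (hx.trans hxy) _)
  have h5 : -(b ^ (m + 2) * ((m + 1) * b ^ m * (y - x))) ≤ lam * (y ^ (m + 1) - x ^ (m + 1)) := by
    have := mul_le_mul_of_nonneg_left h1 (pow_nonneg hb0 (m + 2))
    have := mul_le_mul_of_nonneg_right hlb h3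
    linarith
  have key : η * ((3 * m + 4) * b ^ (2 * m + 2) * (y - x)) ≤ y - x := by
    have := mul_le_mul_of_nonneg_right hb hd
    push_cast at this
    calc _ = η * (3 * (m + 2) - 2) * b ^ (2 * m + 2) * (y - x) := by ring
      _ ≤ _ := by linarith
  have h6 : (y ^ (2 * m + 3) - x ^ (2 * m + 3)) - lam * (y ^ (m + 1) - x ^ (m + 1))
      - (lam' - lam) * y ^ (m + 1) ≤ (3 * m + 4) * b ^ (2 * m + 2) * (y - x) := by
    have e : b ^ (m + 2) * ((m + 1) * b ^ m * (y - x)) = (m + 1) * b ^ (2 * m + 2) * (y - x) := by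
      ring
    rw [e] at h5
    push_cast at h2
    have e' : (2 * (m : ℝ) + 2 + 1) * b ^ (2 * m + 2) * (y - x)
      + (m + 1) * b ^ (2 * m + 2) * (y - x) = (3 * m + 4) * b ^ (2 * m + 2) * (y - x) := by ring
    linarith
  have h7 := mul_le_mul_of_nonneg_left h6 hη
  have e3 : x - η * (x ^ (m + 1) * (x ^ (m + 2) - lam))
      = x - η * (x ^ (2 * m + 3) - lam * x ^ (m + 1)) := by ring
  have e4 : y - η * (y ^ (m + 1) * (y ^ (m + 2) - lam'))
      = y - η * (y ^ (2 * m + 3) - lam' * y ^ (m + 1)) := by ring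
  rw [e3, e4]
  nlinarith [h7, key]

theorem gdStep_nonneg (hN : 2 ≤ N) (hη : 0 ≤ η) (hb : η * (3 * N - 2) * b ^ (2 * N - 2) ≤ 1)
    {lam x : ℝ} (hlb : -b ^ N ≤ lam) (hx : 0 ≤ x) (hy : x ≤ b) : 0 ≤ gdStep N η lam x := by
  have h := gdStep_mono hN hη hb le_rfl hlb le_rfl hx hy
  have h0 : gdStep N η lam 0 = 0 := by
    have : N - 1 ≠ 0 := by omega
    simp [gdStep, this]
  rwa [h0] at h

theorem gdStep_le (hN : 2 ≤ N) (hη : 0 ≤ η) (hb : η * (3 * N - 2) * b ^ (2 * N - 2) ≤ 1)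
    {lam x M : ℝ} (hlb : -b ^ N ≤ lam) (hM : lam ≤ M ^ N) (hMb : M ≤ b) (hx : 0 ≤ x) (hy : x ≤ M) :
    gdStep N η lam x ≤ M :=
  (gdStep_mono hN hη hb hM hlb hx hy hMb).trans_eq (gdStep_fixed _ _ _)

variable {α : ℝ}

/-- The bound `M` is separate from the step-size bound `b`: it is taken as the limit `s` when `lam =
s ^ N`, as `b` in general, and as `α` itself when `lam ≤ α ^ N`. -/
theorem gdScalar_mem (hN : 2 ≤ N) (hη : 0 ≤ η) (hb : η * (3 * N - 2) * b ^ (2 * N - 2) ≤ 1)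
    {lam M : ℝ} (hlb : -b ^ N ≤ lam) (hM : lam ≤ M ^ N) (hMb : M ≤ b) (hα : 0 ≤ α) (hαM : α ≤ M)
    (k : ℕ) : 0 ≤ gdScalar N η lam α k ∧ gdScalar N η lam α k ≤ M := by
  induction k with
  | zero => exact ⟨hα, hαM⟩
  | succ k ih =>
    exact ⟨gdStep_nonneg hN hη hb hlb ih.1 (ih.2.trans hMb),
      gdStep_le hN hη hb hlb hM hMb ih.1 ih.2⟩

theorem gdScalar_mono_left (hN : 2 ≤ N) (hη : 0 ≤ η)
    (hb : η * (3 * N - 2) * b ^ (2 * N - 2) ≤ 1)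
    {lam lam' : ℝ} (hl : lam ≤ lam') (hlb : -b ^ N ≤ lam) (hlb' : lam' ≤ b ^ N) (hα : 0 ≤ α)
    (hαb : α ≤ b) (k : ℕ) : gdScalar N η lam α k ≤ gdScalar N η lam' α k := by
  induction k with
  | zero => exact le_rfl
  | succ k ih =>
    exact gdStep_mono hN hη hb hl hlb (gdScalar_mem hN hη hb hlb (hl.trans hlb') le_rfl hα hαb k).1
      ih (gdScalar_mem hN hη hb (hlb.trans hl) hlb' le_rfl hα hαb k).2

theorem gdScalar_monotone (hN : 2 ≤ N) (hη : 0 ≤ η)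
    (hb : η * (3 * N - 2) * b ^ (2 * N - 2) ≤ 1) {s : ℝ} (hα : 0 ≤ α) (hαs : α ≤ s)
    (hsb : s ≤ b) : Monotone (gdScalar N η (s ^ N) α) := by
  have hlb : -b ^ N ≤ s ^ N := by
    have := pow_nonneg (hα.trans hαs) N
    have := pow_nonneg ((hα.trans hαs).trans hsb) N
    linarith
  refine monotone_nat_of_le_succ fun k => ?_
  obtain ⟨h0, h1⟩ := gdScalar_mem hN hη hb hlb le_rfl hsb hα hαs k
  change _ ≤ gdStep N η (s ^ N) _
  have h2 := pow_le_pow_left₀ h0 h1 N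
  have : 0 ≤ η * (gdScalar N η (s ^ N) α k ^ (N - 1) * (s ^ N - gdScalar N η (s ^ N) α k ^ N)) :=
    mul_nonneg hη (mul_nonneg (pow_nonneg h0 _) (sub_nonneg.2 h2))
  unfold gdStep
  linarith

end Step

/-! ### Comparison of the Euler scheme with its flow -/

section Euler

variable {f : ℝ → ℝ} {d : ℕ → ℝ} {α η m : ℝ}

theorem integral_one_div_le (hc : ContinuousOn f (Set.Icc α m)) (hpos : ∀ x ∈ Set.Icc α m, 0 < f x)
    (hmono : MonotoneOn f (Set.Icc α m)) {x y : ℝ} (hx : α ≤ x) (hxy : x ≤ y) (hy : y ≤ m) :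
    ∫ t in x..y, 1 / f t ≤ (y - x) / f x := by
  have hsub : Set.Icc x y ⊆ Set.Icc α m := Set.Icc_subset_Icc hx hy
  have hi : IntervalIntegrable (fun t => 1 / f t) MeasureTheory.volume x y := by
    apply ContinuousOn.intervalIntegrable
    rw [Set.uIcc_of_le hxy]
    exact continuousOn_const.div (hc.mono hsub) fun t ht => (hpos t (hsub ht)).ne'
  have h := intervalIntegral.integral_mono_on hxy hi (intervalIntegrable_const (c := 1 / f x))
    fun t ht => one_div_le_one_div_of_le (hpos x ⟨hx, hxy.trans hy⟩)
      (hmono ⟨hx, hxy.trans hy⟩ (hsub ht) ht.1)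
  rw [intervalIntegral.integral_const, smul_eq_mul, mul_one_div] at h
  exact h

theorem le_integral_one_div (hc : ContinuousOn f (Set.Icc α m)) (hpos : ∀ x ∈ Set.Icc α m, 0 < f x)
    (hmono : MonotoneOn f (Set.Icc α m)) {x y : ℝ} (hx : α ≤ x) (hxy : x ≤ y) (hy : y ≤ m) :
    (y - x) / f y ≤ ∫ t in x..y, 1 / f t := by
  have hsub : Set.Icc x y ⊆ Set.Icc α m := Set.Icc_subset_Icc hx hy
  have hi : IntervalIntegrable (fun t => 1 / f t) MeasureTheory.volume x y := by
    apply ContinuousOn.intervalIntegrable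
    rw [Set.uIcc_of_le hxy]
    exact continuousOn_const.div (hc.mono hsub) fun t ht => (hpos t (hsub ht)).ne'
  have h := intervalIntegral.integral_mono_on hxy (intervalIntegrable_const (c := 1 / f y)) hi
    fun t ht => one_div_le_one_div_of_le (hpos t (hsub ht))
      (hmono (hsub ht) ⟨hx.trans hxy, hy⟩ ht.2)
  rw [intervalIntegral.integral_const, smul_eq_mul, mul_one_div] at h
  exact h

theorem integral_one_div_add (hc : ContinuousOn f (Set.Icc α m))
    (hpos : ∀ x ∈ Set.Icc α m, 0 < f x) {x y : ℝ} (hx : α ≤ x) (hxy : x ≤ y) (hy : y ≤ m) :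
    (∫ t in α..x, 1 / f t) + ∫ t in x..y, 1 / f t = ∫ t in α..y, 1 / f t := by
  have hi : ∀ u v, α ≤ u → u ≤ v → v ≤ m →
      IntervalIntegrable (fun t => 1 / f t) MeasureTheory.volume u v := by
    intro u v hu huv hv
    have hsub : Set.Icc u v ⊆ Set.Icc α m := Set.Icc_subset_Icc hu hv
    apply ContinuousOn.intervalIntegrable
    rw [Set.uIcc_of_le huv]
    exact continuousOn_const.div (hc.mono hsub) fun t ht => (hpos t (hsub ht)).ne'
  exact intervalIntegral.integral_add_adjacent_intervals (hi _ _ le_rfl hx (hxy.trans hy))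
    (hi _ _ hx hxy hy)

/-- The Euler scheme of an increasing field lags behind its flow. -/
theorem euler_le_of_le_integral (hc : ContinuousOn f (Set.Icc α m))
    (hpos : ∀ x ∈ Set.Icc α m, 0 < f x) (hmono : MonotoneOn f (Set.Icc α m)) (hη : 0 < η)
    (hd0 : d 0 = α) (hds : ∀ k, d (k + 1) = d k + η * f (d k)) (hdm : Monotone d)
    {k : ℕ} (hαm : α ≤ m) (hk : η * k ≤ ∫ t in α..m, 1 / f t) : d k ≤ m := by
  have hdα : ∀ j, α ≤ d j := fun j => hd0 ▸ hdm (Nat.zero_le j)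
  -- On each step `f ≥ f (d j)`, so the flow crosses the step in time at most `η`.
  have key : ∀ j, d j ≤ m → ∫ t in α..d j, 1 / f t ≤ η * j := by
    intro j
    induction j with
    | zero => intro _; simp [hd0]
    | succ j ih =>
      intro hj
      have h1 : d j ≤ d (j + 1) := hdm (Nat.le_succ j)
      have h2 := ih (h1.trans hj)
      have h3 := integral_one_div_le hc hpos hmono (hdα j) h1 hj
      have h4 := (hpos (d j) ⟨hdα j, h1.trans hj⟩).ne'
      rw [hds j, add_sub_cancel_left, mul_div_cancel_right₀ _ h4, ← hds j] at h3
      rw [← integral_one_div_add hc hpos (hdα j) h1 hj]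
      push_cast
      linarith
  induction k with
  | zero => rw [hd0]; exact hαm
  | succ j ih =>
    push_cast at hk
    have h0 : d j ≤ m := ih (by linarith)
    -- If the next iterate overshot `m`, the flow would cross from `d j` to `m` in time less than
    -- `η`, so it would reach `m` before time `η * (j + 1)`.
    by_contra! hcon
    have h4 := hpos (d j) ⟨hdα j, h0⟩
    have h3 := integral_one_div_le hc hpos hmono (hdα j) h0 le_rfl
    have h5 : (m - d j) / f (d j) < η := by
      rw [div_lt_iff₀ h4]
      have := hds j
      linarith
    have h6 := key j h0
    have h7 := integral_one_div_add hc hpos (hdα j) h0 le_rfl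
    linarith

/-- The lag of the Euler scheme of an increasing field behind its flow. -/
theorem euler_time_le (hc : ContinuousOn f (Set.Icc α m))
    (hpos : ∀ x ∈ Set.Icc α m, 0 < f x) (hmono : MonotoneOn f (Set.Icc α m)) (hη : 0 < η)
    (hd0 : d 0 = α) (hds : ∀ k, d (k + 1) = d k + η * f (d k)) (hdm : Monotone d)
    (hαm : α ≤ m) (k : ℕ) (hk : d k ≤ m) :
    η * k ≤ (∫ t in α..d k, 1 / f t) + η * ((f (d k) - f α) / f α) := by
  have hdα : ∀ j, α ≤ d j := fun j => hd0 ▸ hdm (Nat.zero_le j)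
  have hfα := hpos α ⟨le_rfl, hαm⟩
  induction k with
  | zero => simp [hd0]
  | succ j ih =>
    have h1 : d j ≤ d (j + 1) := hdm (Nat.le_succ j)
    have h2 := ih (h1.trans hk)
    have h3 := le_integral_one_div hc hpos hmono (hdα j) h1 hk
    have m1 : d j ∈ Set.Icc α m := ⟨hdα j, h1.trans hk⟩
    have m2 : d (j + 1) ∈ Set.Icc α m := ⟨hdα (j + 1), hk⟩
    have p2 := hpos _ m2
    have h5 : f (d j) ≤ f (d (j + 1)) := hmono m1 m2 h1
    have h6 : f α ≤ f (d (j + 1)) := hmono ⟨le_rfl, hαm⟩ m2 (hdα _)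
    -- The time lost in one step is at most `η` times the relative increase of `f`. Replacing its
    -- denominator by the smaller `f α` makes the losses telescope.
    have h7 : η ≤ (d (j + 1) - d j) / f (d (j + 1))
        + η * ((f (d (j + 1)) - f (d j)) / f α) := by
      have e : (d (j + 1) - d j) / f (d (j + 1))
          = η - η * ((f (d (j + 1)) - f (d j)) / f (d (j + 1))) := by
        rw [hds j, add_sub_cancel_left, ← hds j]
        field_simp
        ring
      have : (f (d (j + 1)) - f (d j)) / f (d (j + 1)) ≤ (f (d (j + 1)) - f (d j)) / f α :=
        div_le_div_of_nonneg_left (sub_nonneg.2 h5) hfα h6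
      have := mul_le_mul_of_nonneg_left this hη.le
      linarith
    rw [← integral_one_div_add hc hpos (hdα j) h1 hk]
    have e : (f (d (j + 1)) - f α) / f α
        = (f (d (j + 1)) - f (d j)) / f α + (f (d j) - f α) / f α := by ring
    rw [e]
    push_cast
    linarith

end Euler

/-! ### The constant `c_N` and the range where the field increases -/

theorem cN_mem {N : ℕ} (hN : 2 ≤ N) : 0 < cN N ∧ cN N < 1 / 2 := by
  have h : (2 : ℝ) ≤ N := by exact_mod_cast hN
  unfold cN
  constructor
  · apply div_pos <;> linarith
  · rw [div_lt_div_iff₀ (by linarith) (by norm_num)]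
    linarith

theorem rpow_one_div_pow {N : ℕ} (hN : N ≠ 0) {x : ℝ} (hx : 0 ≤ x) :
    (x ^ (1 / (N : ℝ))) ^ N = x := by
  rw [one_div]
  exact Real.rpow_inv_natCast_pow hx hN

section Field

variable {N : ℕ} {lam α m : ℝ}

/-- The derivative is `y^(N-2) ((N-1) lam - (2N-1) y^N)`, which changes sign exactly at `y^N = c_N
lam`; this is why the first phase stops at that level. -/
theorem gdField_monotoneOn (hN : 2 ≤ N) (hm : m ^ N ≤ cN N * lam) (hα : 0 ≤ α) :
    MonotoneOn (fun y : ℝ => y ^ (N - 1) * (lam - y ^ N)) (Set.Icc α m) := by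
  obtain ⟨p, rfl⟩ : ∃ p, N = p + 2 := ⟨N - 2, by omega⟩
  simp only [show p + 2 - 1 = p + 1 by omega]
  have hd : ∀ y : ℝ, HasDerivAt (fun y : ℝ => y ^ (p + 1) * (lam - y ^ (p + 2)))
      (y ^ p * ((p + 1) * lam - (2 * p + 3) * y ^ (p + 2))) y := by
    intro y
    have h := (hasDerivAt_pow (p + 1) y).mul ((hasDerivAt_pow (p + 2) y).const_sub lam)
    refine h.congr_deriv ?_
    simp only [Nat.add_sub_cancel, show p + 2 - 1 = p + 1 by omega]
    push_cast
    ring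
  refine monotoneOn_of_deriv_nonneg (convex_Icc _ _) (by fun_prop)
    (fun y _ => (hd y).differentiableAt.differentiableWithinAt) fun y hy => ?_
  rw [interior_Icc] at hy
  rw [(hd y).deriv]
  have hy0 : 0 ≤ y := hα.trans hy.1.le
  refine mul_nonneg (pow_nonneg hy0 _) ?_
  have h1 : y ^ (p + 2) ≤ cN (p + 2) * lam := (pow_le_pow_left₀ hy0 hy.2.le _).trans hm
  have h2 : cN (p + 2) * lam * (2 * p + 3) = (p + 1) * lam := by
    have : 2 * (p : ℝ) + 3 ≠ 0 := by positivity
    unfold cN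
    push_cast
    have e : 2 * ((p : ℝ) + 2) - 1 = 2 * p + 3 := by ring
    rw [e]
    field_simp
    ring
  have h3 := mul_le_mul_of_nonneg_right h1 (show (0 : ℝ) ≤ 2 * p + 3 by positivity)
  linarith

theorem gdField_pos (hm : m ^ N < lam) (hα : 0 < α) :
    ∀ y ∈ Set.Icc α m, 0 < y ^ (N - 1) * (lam - y ^ N) := by
  intro y hy
  have hy0 : 0 < y := hα.trans_le hy.1
  have := pow_le_pow_left₀ hy0.le hy.2 N
  exact mul_pos (pow_pos hy0 _) (by linarith)

end Field

/-! ### Scalar time estimates: growth phase and linear phase -/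

section Window

variable {N : ℕ} {η b α s : ℝ}

/-- Before the time `T₁` the iterate stays below `ε' * lam`. -/
theorem gdScalar_pow_le_of_le_Tone (hN : 2 ≤ N) (hη : 0 < η)
    (hb : η * (3 * N - 2) * b ^ (2 * N - 2) ≤ 1) (hα : 0 < α) (hs : 0 < s) (hsb : s ≤ b)
    {ε' : ℝ} (hε : 0 < ε') (hε' : ε' ≤ cN N) (hαs : α ^ N < ε' * s ^ N) {k : ℕ}
    (hk : (k : ℝ) ≤ Tone N (s ^ N) ε' α η) : gdScalar N η (s ^ N) α k ^ N ≤ ε' * s ^ N := by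
  have hN0 : N ≠ 0 := by omega
  have hc := cN_mem hN
  have hsN : 0 < s ^ N := pow_pos hs N
  have hlam : 0 ≤ ε' * s ^ N := by positivity
  set m := (ε' * s ^ N) ^ (1 / (N : ℝ)) with hm
  have hm0 : 0 ≤ m := Real.rpow_nonneg hlam _
  have hmN : m ^ N = ε' * s ^ N := rpow_one_div_pow hN0 hlam
  have hαm : α ≤ m := (pow_lt_pow_iff_left₀ hα.le hm0 hN0).1 (hmN ▸ hαs) |>.le
  have hms : m ^ N < s ^ N := by rw [hmN]; nlinarith
  have hms' : m < s := (pow_lt_pow_iff_left₀ hm0 hs.le hN0).1 hms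
  have hmono := gdScalar_monotone hN hη.le hb hα.le (hαm.trans hms'.le) hsb
  have h := euler_le_of_le_integral (f := fun y : ℝ => y ^ (N - 1) * (s ^ N - y ^ N))
    (d := gdScalar N η (s ^ N) α) (α := α) (η := η) (m := m) (by fun_prop) (gdField_pos hms hα)
    (gdField_monotoneOn hN (by rw [hmN]; gcongr) hα.le) hη rfl
    (fun k => by simp only [gdScalar, gdStep]; ring) hmono (k := k) hαm (by
      unfold Tone flowTime at hk
      rw [← hm, one_div_mul_eq_div, le_div_iff₀ hη] at hk
      linarith)
  have h0 : 0 ≤ gdScalar N η (s ^ N) α k := hα.le.trans (hmono (Nat.zero_le k))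
  exact (pow_le_pow_left₀ h0 h N).trans_eq hmN

/-- Here the flow-time integral runs backwards. The window then contains at most the step `k = 0`,
where the iterate is still `α`. -/
theorem Tone_nonpos (hN : N ≠ 0) (hη : 0 < η) (hα : 0 < α) {lam ε' : ℝ} (hlam : α ^ N < lam)
    (hε : 0 ≤ ε') (h : ε' * lam ≤ α ^ N) : Tone N lam ε' α η ≤ 0 := by
  have hl : 0 ≤ ε' * lam := mul_nonneg hε ((pow_pos hα N).le.trans hlam.le)
  have hm0 : 0 ≤ (ε' * lam) ^ (1 / (N : ℝ)) := Real.rpow_nonneg hl _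
  have hmα : (ε' * lam) ^ (1 / (N : ℝ)) ≤ α :=
    (pow_le_pow_iff_left₀ hm0 hα.le hN).1 ((rpow_one_div_pow hN hl).trans_le h)
  unfold Tone flowTime
  rw [intervalIntegral.integral_symm]
  have : 0 ≤ ∫ y in (ε' * lam) ^ (1 / (N : ℝ))..α, 1 / (y ^ (N - 1) * (lam - y ^ N)) := by
    refine intervalIntegral.integral_nonneg hmα fun y hy => ?_
    have hy0 : 0 ≤ y := hm0.trans hy.1
    have := pow_le_pow_left₀ hy0 hy.2 N
    exact one_div_nonneg.2 (mul_nonneg (pow_nonneg hy0 _) (by linarith))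
  have h2 : 0 ≤ 1 / η := by positivity
  nlinarith

/-- The number of steps in which the iterate reaches the level `m`. -/
theorem le_gdScalar_of_time_le (hN : 2 ≤ N) (hη : 0 < η)
    (hb : η * (3 * N - 2) * b ^ (2 * N - 2) ≤ 1) (hα : 0 < α) (hs : 0 < s) (hsb : s ≤ b)
    {m : ℝ} (hαm : α ≤ m) (hm : m ^ N ≤ cN N * s ^ N) {k : ℕ}
    (hk : 1 / η * flowTime N (s ^ N) m α + ((m / α) ^ (N - 1) - 1) ≤ k) :
    m ≤ gdScalar N η (s ^ N) α k := by
  have hN0 : N ≠ 0 := by omega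
  have hc := cN_mem hN
  have hsN : 0 < s ^ N := pow_pos hs N
  have hm0 : 0 ≤ m := hα.le.trans hαm
  have hms : m ^ N < s ^ N := by nlinarith
  have hms' : m < s := (pow_lt_pow_iff_left₀ hm0 hs.le hN0).1 hms
  have hmono := gdScalar_monotone hN hη.le hb hα.le (hαm.trans hms'.le) hsb
  by_contra! hcon
  set d := gdScalar N η (s ^ N) α with hd
  have hcf : ContinuousOn (fun y : ℝ => y ^ (N - 1) * (s ^ N - y ^ N)) (Set.Icc α m) := by fun_prop
  have hpf := gdField_pos (α := α) hms hα
  have hmf := gdField_monotoneOn (α := α) hN hm hα.le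
  have h := euler_time_le (f := fun y : ℝ => y ^ (N - 1) * (s ^ N - y ^ N)) (d := d) hcf hpf hmf
    hη rfl (fun k => by simp only [hd, gdScalar, gdStep]; ring) hmono hαm k hcon.le
  have hαd : α ≤ d k := hmono (Nat.zero_le k)
  have h1 := integral_one_div_add (f := fun y : ℝ => y ^ (N - 1) * (s ^ N - y ^ N)) hcf hpf
    hαd hcon.le le_rfl
  have h2 := le_integral_one_div (f := fun y : ℝ => y ^ (N - 1) * (s ^ N - y ^ N)) hcf hpf hmf
    hαd hcon.le le_rfl
  have h3 := div_pos (sub_pos.2 hcon) (hpf m ⟨hαm, le_rfl⟩)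
  have hpα := hpf α ⟨le_rfl, hαm⟩
  -- The factor `s ^ N - y ^ N` decreases in `y`, so only `y ^ (N - 1)` contributes to the growth of
  -- the field. The total lag is therefore at most `(m / α) ^ (N - 1) - 1` steps.
  have h4 : ((d k ^ (N - 1) * (s ^ N - d k ^ N)) - α ^ (N - 1) * (s ^ N - α ^ N))
      / (α ^ (N - 1) * (s ^ N - α ^ N)) ≤ (m / α) ^ (N - 1) - 1 := by
    rw [sub_div, div_self hpα.ne']
    have h5 : d k ^ (N - 1) * (s ^ N - d k ^ N) ≤ m ^ (N - 1) * (s ^ N - α ^ N) := by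
      have a1 := pow_le_pow_left₀ (hα.le.trans hαd) hcon.le (N - 1)
      have a2 := pow_le_pow_left₀ hα.le hαd N
      have a3 := pow_le_pow_left₀ (hα.le.trans hαd) hcon.le N
      exact mul_le_mul a1 (by linarith) (by linarith) (pow_nonneg hm0 _)
    have h6 : (m / α) ^ (N - 1)
        = m ^ (N - 1) * (s ^ N - α ^ N) / (α ^ (N - 1) * (s ^ N - α ^ N)) := by
      rw [div_pow, mul_div_mul_right]
      exact (pos_of_mul_pos_right hpα (pow_nonneg hα.le _)).ne'
    rw [h6]
    gcongr
  have h5 := mul_le_mul_of_nonneg_left hk hη.le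
  have h6 : η * (1 / η * flowTime N (s ^ N) m α + ((m / α) ^ (N - 1) - 1))
      = flowTime N (s ^ N) m α + η * ((m / α) ^ (N - 1) - 1) := by
    field_simp
  rw [h6] at h5
  have h7 := mul_le_mul_of_nonneg_left h4 hη.le
  unfold flowTime at h5
  linarith

/-- Linear convergence once the level `m` is reached. -/
theorem sub_gdStep_le (hN : 2 ≤ N) (hη : 0 ≤ η) {m x : ℝ} (hm : 0 ≤ m) (hx : m ≤ x)
    (hxs : x ≤ s) : s - gdStep N η (s ^ N) x ≤ (1 - η * N * m ^ (2 * N - 2)) * (s - x) := by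
  have hx0 : 0 ≤ x := hm.trans hx
  -- A mean value bound from below; for `p = N`, with a further factor `x ^ (N - 1) ≥ m ^ (N - 1)`,
  -- it gives the contraction rate.
  have h1 : ∀ p : ℕ, p * m ^ (p - 1) * (s - x) ≤ s ^ p - x ^ p := by
    intro p
    induction p with
    | zero => simp
    | succ p ih =>
      have e : s ^ (p + 1) - x ^ (p + 1) = x * (s ^ p - x ^ p) + s ^ p * (s - x) := by ring
      rw [e]
      have a1 : m ^ p * (s - x) ≤ s ^ p * (s - x) :=
        mul_le_mul_of_nonneg_right (pow_le_pow_left₀ hm (hx.trans hxs) _) (sub_nonneg.2 hxs)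
      have a2 : m * (p * m ^ (p - 1) * (s - x)) ≤ x * (s ^ p - x ^ p) := by
        apply mul_le_mul hx ih _ hx0
        have := sub_nonneg.2 hxs
        positivity
      have a3 : m * (p * m ^ (p - 1) * (s - x)) = p * m ^ p * (s - x) := by
        rcases p with _ | p
        · simp
        · rw [Nat.add_sub_cancel]; ring
      rw [Nat.add_sub_cancel]
      push_cast
      linarith
  have h2 := h1 N
  have h3 : m ^ (N - 1) * (N * m ^ (N - 1) * (s - x)) ≤ x ^ (N - 1) * (s ^ N - x ^ N) := by
    have := sub_nonneg.2 hxs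
    apply mul_le_mul (pow_le_pow_left₀ hm hx _) h2 (by positivity) (pow_nonneg hx0 _)
  have h4 := mul_le_mul_of_nonneg_left h3 hη
  have e : m ^ (2 * N - 2) = m ^ (N - 1) * m ^ (N - 1) := by
    rw [← pow_add]; congr 1; omega
  unfold gdStep
  rw [e]
  linarith

/-- By Bernoulli, `(1 - 1/(2N))^N ≥ 1/2 > c_N`. This ensures that the target accuracy `ε / (4N)` is
no coarser than the relative error at the end of the first phase, so the last term of `TId` is
nonnegative. -/
theorem one_sub_cN_rpow_ge (hN : 2 ≤ N) : 1 / (2 * N) ≤ 1 - cN N ^ (1 / (N : ℝ)) := by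
  have hc := cN_mem hN
  have hN0 : N ≠ 0 := by omega
  have hNR : (2 : ℝ) ≤ N := by exact_mod_cast hN
  have h2 : 1 / (2 * (N : ℝ)) ≤ 1 / 4 := by
    apply one_div_le_one_div_of_le <;> linarith
  have h0 : 0 ≤ 1 - 1 / (2 * (N : ℝ)) := by linarith
  have hB := one_add_mul_le_pow (a := -(1 / (2 * (N : ℝ)))) (by linarith) N
  have e : (N : ℝ) * -(1 / (2 * (N : ℝ))) = -(1 / 2) := by field_simp
  rw [e] at hB
  have : cN N ^ (1 / (N : ℝ)) ≤ 1 - 1 / (2 * (N : ℝ)) := by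
    refine (pow_le_pow_iff_left₀ (Real.rpow_nonneg hc.1.le _) h0 hN0).1 ?_
    rw [rpow_one_div_pow hN0 hc.1.le, sub_eq_add_neg]
    linarith
  linarith

/-- After the time `T_N^Id` the accuracy is reached. -/
theorem le_gdScalar_of_TId_le (hN : 2 ≤ N) (hη : 0 < η)
    (hb : η * (3 * N - 2) * b ^ (2 * N - 2) ≤ 1) (hα : 0 < α) (hs : 0 < s) (hsb : s ≤ b)
    (hαs : α ^ N < cN N * s ^ N) {ε : ℝ} (hε : 0 < ε) (hε1 : ε ≤ 1) {k : ℕ}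
    (hk : TId N (s ^ N) ((s ^ N) ^ (1 / (N : ℝ)) / (4 * N) * ε) α η ≤ k) :
    s * (1 - ε / (4 * N)) ≤ gdScalar N η (s ^ N) α k := by
  have hN0 : N ≠ 0 := by omega
  have hNR : (2 : ℝ) ≤ N := by exact_mod_cast hN
  have hc := cN_mem hN
  have hsN : 0 < s ^ N := pow_pos hs N
  have hss : (s ^ N) ^ (1 / (N : ℝ)) = s := by
    rw [one_div]; exact Real.pow_rpow_inv_natCast hs.le hN0
  have hcl : 0 < cN N * s ^ N := mul_pos hc.1 hsN
  set m := (cN N * s ^ N) ^ (1 / (N : ℝ)) with hm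
  have hm0 : 0 < m := Real.rpow_pos_of_pos hcl _
  have hmN : m ^ N = cN N * s ^ N := rpow_one_div_pow hN0 hcl.le
  have hαm : α ≤ m := (pow_lt_pow_iff_left₀ hα.le hm0.le hN0).1 (hmN ▸ hαs) |>.le
  have hmc : m = cN N ^ (1 / (N : ℝ)) * s := by
    rw [hm, Real.mul_rpow hc.1.le hsN.le, hss]
  have hg := one_sub_cN_rpow_ge hN
  set g := cN N ^ (1 / (N : ℝ)) with hgd
  have hg0 : 0 < g := Real.rpow_pos_of_pos hc.1 _
  have hN4 : 0 < 1 / (2 * (N : ℝ)) := by positivity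
  have hms : m ≤ s := by rw [hmc]; nlinarith
  have hpow : (cN N * s ^ N) ^ (2 - 2 / (N : ℝ)) = m ^ (2 * N - 2) := by
    rw [hm, ← Real.rpow_mul_natCast hcl.le]
    congr 1
    rw [Nat.cast_sub (by omega)]
    push_cast
    field_simp
  unfold TId at hk
  rw [hss, hpow, ← hm, ← hgd] at hk
  set ρ := 1 - η * N * m ^ (2 * N - 2) with hρ
  have hmb : m ^ (2 * N - 2) < b ^ (2 * N - 2) := by
    refine pow_lt_pow_left₀ (lt_of_lt_of_le ?_ hsb) hm0.le (by omega)
    rw [hmc]; nlinarith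
  have hρ1 : ρ < 1 := by
    have : 0 < η * N * m ^ (2 * N - 2) := by positivity
    linarith
  have hρ0 : 0 < ρ := by
    have h1 : η * N * m ^ (2 * N - 2) < η * N * b ^ (2 * N - 2) := by gcongr
    have h2 : η * N * b ^ (2 * N - 2) ≤ η * (3 * N - 2) * b ^ (2 * N - 2) := by
      have : 0 ≤ b ^ (2 * N - 2) := (pow_pos hm0 _).le.trans hmb.le
      gcongr
      linarith
    linarith
  have hlρ : Real.log ρ < 0 := Real.log_neg hρ0 hρ1
  have h1g : 0 < 1 - g := hN4.trans_le hg
  have hlg : Real.log (1 - g) < 0 := Real.log_neg h1g (by linarith)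
  rw [abs_of_neg hlρ, abs_of_neg hlg] at hk
  have hδ : 0 < s / (4 * N) * ε := by positivity
  set δ := s / (4 * N) * ε with hδd
  -- Since `1 - g < 1`, subtracting the absolute logarithm turns the numerator of `TId` into `log (s
  -- (1 - g) / δ)`: the initial error of the linear phase over the final one.
  have hquot : Real.log (s / δ) - -Real.log (1 - g) = Real.log (s * (1 - g) / δ) := by
    rw [mul_div_right_comm, Real.log_mul (by positivity) h1g.ne']
    ring
  rw [hquot] at hk
  have hx1 : 1 ≤ s * (1 - g) / δ := by
    rw [le_div_iff₀ hδ, one_mul, hδd]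
    calc s / (4 * N) * ε ≤ s / (4 * N) * 1 := by gcongr
      _ ≤ s * (1 / (2 * N)) := by
        rw [mul_one, mul_one_div]; gcongr; norm_num
      _ ≤ s * (1 - g) := by gcongr
  have hlog0 : 0 ≤ Real.log (s * (1 - g) / δ) := Real.log_nonneg hx1
  -- the first phase
  have hF0 : 0 ≤ flowTime N (s ^ N) m α := by
    refine intervalIntegral.integral_nonneg hαm fun y hy => ?_
    have := gdField_pos (N := N) (lam := s ^ N) (m := m) (by rw [hmN]; nlinarith) hα y hy
    positivity
  have hr1 : 1 ≤ (m / α) ^ (N - 1) := one_le_pow₀ ((one_le_div hα).2 hαm)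
  set A := 1 / η * flowTime N (s ^ N) m α + ((m / α) ^ (N - 1) - 1) with hA
  have hA0 : 0 ≤ A := add_nonneg (by positivity) (by linarith)
  have hceil := Int.le_ceil ((m / α) ^ (N - 1))
  -- Rounding `A` up costs less than one step, which the `-1` in `A` compensates; the ceiling in
  -- `TId` covers the rest.
  set k₀ := ⌈A⌉₊ with hk₀
  have hk₀A : (k₀ : ℝ) < A + 1 := Nat.ceil_lt_add_one hA0
  have hphase := le_gdScalar_of_time_le hN hη hb hα hs hsb hαm hmN.le (Nat.le_ceil A)
  have hquot0 : 0 ≤ Real.log (s * (1 - g) / δ) / -Real.log ρ :=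
    div_nonneg hlog0 (by linarith)
  have hkk₀ : k₀ ≤ k := by
    have : (k₀ : ℝ) ≤ k := by linarith
    exact_mod_cast this
  have hmono := gdScalar_monotone hN hη.le hb hα.le (hαm.trans hms) hsb
  have hlb : -b ^ N ≤ s ^ N := by
    have : 0 ≤ b ^ N := pow_nonneg (hs.le.trans hsb) N
    linarith
  -- the second phase
  have hlin : ∀ j, s - gdScalar N η (s ^ N) α (k₀ + j) ≤ ρ ^ j * (s * (1 - g)) := by
    intro j
    induction j with
    | zero =>
      have e : s * (1 - g) = s - m := by rw [hmc]; ring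
      rw [pow_zero, one_mul, e]
      exact sub_le_sub_left hphase s
    | succ j ih =>
      have h1 := sub_gdStep_le hN hη.le hm0.le (hphase.trans (hmono (Nat.le_add_right k₀ j)))
        (gdScalar_mem hN hη.le hb hlb le_rfl hsb hα.le (hαm.trans hms) (k₀ + j)).2
      calc _ ≤ _ := h1
        _ ≤ ρ * (ρ ^ j * (s * (1 - g))) := mul_le_mul_of_nonneg_left ih hρ0.le
        _ = _ := by ring
  have hfin := hlin (k - k₀)
  rw [Nat.add_sub_cancel' hkk₀] at hfin
  have hdec : ρ ^ (k - k₀) * (s * (1 - g)) ≤ δ := by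
    have hj : Real.log (s * (1 - g) / δ) / -Real.log ρ ≤ ((k - k₀ : ℕ) : ℝ) := by
      rw [Nat.cast_sub hkk₀]
      linarith
    rw [div_le_iff₀ (by linarith)] at hj
    have h1 : Real.log (ρ ^ (k - k₀)) + Real.log (s * (1 - g) / δ) ≤ 0 := by
      rw [Real.log_pow]
      linarith
    rw [← Real.log_mul (by positivity) (by positivity)] at h1
    have h2 : ρ ^ (k - k₀) * (s * (1 - g) / δ) ≤ 1 := by
      by_contra! hcon
      exact absurd h1 (not_le.2 (Real.log_pos hcon))
    rw [← mul_div_assoc, div_le_one hδ] at h2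
    exact h2
  have e : s * (1 - ε / (4 * N)) = s - δ := by rw [hδd]; ring
  rw [e]
  linarith

/-- Bernoulli for the exponent `N - 1` times one more factor leaves the extra term `(N - 1) x ^ 2 >
0`. It converts the accuracy of a single factor into that of the product, and its strictness makes
the final Frobenius bound strict. -/
theorem lt_one_sub_div_pow (hN : 2 ≤ N) {ε : ℝ} (hε : 0 < ε) (hε1 : ε ≤ 1) :
    1 - ε / 4 < (1 - ε / (4 * N)) ^ N := by
  have hNR : (2 : ℝ) ≤ N := by exact_mod_cast hN
  obtain ⟨p, rfl⟩ : ∃ p, N = p + 1 := ⟨N - 1, by omega⟩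
  set x := ε / (4 * ((p + 1 : ℕ) : ℝ)) with hx
  have hx0 : 0 < x := by positivity
  have hx1 : x ≤ 1 := by
    rw [hx, div_le_one (by positivity)]
    linarith
  have hpx : ((p : ℝ) + 1) * x = ε / 4 := by
    rw [hx]
    push_cast
    field_simp
  have hp : (0 : ℝ) < p := by
    push_cast at hNR
    linarith
  have hB := one_add_mul_le_pow (a := -x) (by linarith) p
  rw [← sub_eq_add_neg] at hB
  have h1 := mul_le_mul_of_nonneg_left hB (sub_nonneg.2 hx1)
  have h2 : 0 < (p : ℝ) * x ^ 2 := by positivity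
  rw [pow_succ]
  nlinarith

end Window

open Matrix

/-! ## Matrices that are diagonal in an orthonormal basis -/

section Diag

variable {n : ℕ}

/-- The matrix `A` is diagonal in the orthonormal basis `b`, with diagonal `μ`. -/
def IsDiagIn (b : OrthonormalBasis (Fin n) ℝ (EuclideanSpace ℝ (Fin n))) (μ : Fin n → ℝ)
    (A : Matrix (Fin n) (Fin n) ℝ) : Prop :=
  ∀ i, toEuclideanLin A (b i) = μ i • b i

/-- The matrix that is diagonal in the orthonormal basis `b`, with diagonal `μ`. -/
noncomputable def diagMat (b : OrthonormalBasis (Fin n) ℝ (EuclideanSpace ℝ (Fin n)))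
    (μ : Fin n → ℝ) : Matrix (Fin n) (Fin n) ℝ :=
  toEuclideanLin.symm (b.toBasis.constr ℝ fun i => μ i • b i)

variable {b : OrthonormalBasis (Fin n) ℝ (EuclideanSpace ℝ (Fin n))} {μ ν : Fin n → ℝ}
  {A B : Matrix (Fin n) (Fin n) ℝ}

theorem isDiagIn_diagMat (b : OrthonormalBasis (Fin n) ℝ (EuclideanSpace ℝ (Fin n)))
    (μ : Fin n → ℝ) : IsDiagIn b μ (diagMat b μ) := by
  intro i
  rw [diagMat, LinearEquiv.apply_symm_apply]
  simp

theorem matrix_ext_basis (b : OrthonormalBasis (Fin n) ℝ (EuclideanSpace ℝ (Fin n)))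
    (h : ∀ i, toEuclideanLin A (b i) = toEuclideanLin B (b i)) : A = B := by
  apply toEuclideanLin.injective
  apply b.toBasis.ext
  simpa using h

theorem toEuclideanLin_mul_apply (A B : Matrix (Fin n) (Fin n) ℝ) (v : EuclideanSpace ℝ (Fin n)) :
    toEuclideanLin (A * B) v = toEuclideanLin A (toEuclideanLin B v) := by
  rw [toLpLin_mul_same]; rfl

theorem IsDiagIn.eq (hA : IsDiagIn b μ A) (hB : IsDiagIn b μ B) : A = B :=
  matrix_ext_basis b fun i => (hA i).trans (hB i).symm

theorem IsDiagIn.mul (hA : IsDiagIn b μ A) (hB : IsDiagIn b ν B) :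
    IsDiagIn b (fun i => μ i * ν i) (A * B) := by
  intro i
  rw [toEuclideanLin_mul_apply, hB i, map_smul, hA i, smul_smul, mul_comm]

theorem IsDiagIn.pow (hA : IsDiagIn b μ A) (k : ℕ) : IsDiagIn b (fun i => μ i ^ k) (A ^ k) := by
  induction k with
  | zero => intro i; simp
  | succ k ih =>
    simp only [pow_succ]
    exact ih.mul hA

theorem IsDiagIn.sub (hA : IsDiagIn b μ A) (hB : IsDiagIn b ν B) :
    IsDiagIn b (fun i => μ i - ν i) (A - B) := by
  intro i
  rw [map_sub, LinearMap.sub_apply, hA i, hB i, sub_smul]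

theorem IsDiagIn.smul (c : ℝ) (hA : IsDiagIn b μ A) : IsDiagIn b (fun i => c * μ i) (c • A) := by
  intro i
  rw [map_smul, LinearMap.smul_apply, hA i, smul_smul]

theorem IsDiagIn.one : IsDiagIn b (fun _ => 1) (1 : Matrix (Fin n) (Fin n) ℝ) := by
  intro i
  simp

theorem IsDiagIn.inner_apply (hA : IsDiagIn b μ A) (i : Fin n) (v : EuclideanSpace ℝ (Fin n)) :
    inner ℝ (b i) (toEuclideanLin A v) = μ i * inner ℝ (b i) v := by
  conv_lhs => rw [← b.sum_repr v]
  simp only [map_sum, map_smul, hA _, inner_sum, inner_smul_right, b.inner_eq_ite,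
    mul_ite, mul_one, mul_zero, Finset.sum_ite_eq, Finset.mem_univ, if_true,
    b.repr_apply_apply]
  ring

theorem IsDiagIn.isHermitian (hA : IsDiagIn b μ A) : A.IsHermitian := by
  rw [← isSymmetric_toEuclideanLin_iff]
  intro v w
  rw [← b.sum_inner_mul_inner, ← b.sum_inner_mul_inner v]
  refine Finset.sum_congr rfl fun i _ => ?_
  rw [hA.inner_apply, real_inner_comm, hA.inner_apply, real_inner_comm (b i) v]
  ring

theorem IsDiagIn.norm_sq_apply (hA : IsDiagIn b μ A) (v : EuclideanSpace ℝ (Fin n)) :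
    ‖toEuclideanLin A v‖ ^ 2 = ∑ i, μ i ^ 2 * inner ℝ (b i) v ^ 2 := by
  rw [← b.sum_sq_norm_inner_right]
  refine Finset.sum_congr rfl fun i _ => ?_
  rw [hA.inner_apply, Real.norm_eq_abs, sq_abs, mul_pow]

theorem norm_sq_eq_sum_inner_sq (b : OrthonormalBasis (Fin n) ℝ (EuclideanSpace ℝ (Fin n)))
    (v : EuclideanSpace ℝ (Fin n)) : ‖v‖ ^ 2 = ∑ i, inner ℝ (b i) v ^ 2 := by
  rw [← b.sum_sq_norm_inner_right]
  refine Finset.sum_congr rfl fun i _ => ?_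
  rw [Real.norm_eq_abs, sq_abs]

theorem IsDiagIn.trace (hA : IsDiagIn b μ A) :
    LinearMap.trace ℝ _ (toEuclideanLin A) = ∑ i, μ i := by
  rw [LinearMap.trace_eq_sum_inner _ b]
  refine Finset.sum_congr rfl fun i _ => ?_
  rw [hA i, inner_smul_right, b.inner_eq_one, mul_one]

/-! ### The norms in an orthonormal basis -/

theorem frobNorm_nonneg (A : Matrix (Fin n) (Fin n) ℝ) : 0 ≤ frobNorm A := Real.sqrt_nonneg _

/-- By Parseval applied to the rows of `A`, the Frobenius norm can be computed in any orthonormal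
basis. -/
theorem frobNorm_sq (b : OrthonormalBasis (Fin n) ℝ (EuclideanSpace ℝ (Fin n)))
    (A : Matrix (Fin n) (Fin n) ℝ) : frobNorm A ^ 2 = ∑ i, ‖toEuclideanLin A (b i)‖ ^ 2 := by
  have h1 : frobNorm A ^ 2 = ∑ i, ∑ j, A i j ^ 2 :=
    Real.sq_sqrt (Finset.sum_nonneg fun i _ => Finset.sum_nonneg fun j _ => sq_nonneg _)
  have h2 : ∀ v, ‖toEuclideanLin A v‖ ^ 2 = ∑ i, inner ℝ (WithLp.toLp 2 (A i)) v ^ 2 := by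
    intro v
    rw [EuclideanSpace.norm_sq_eq]
    refine Finset.sum_congr rfl fun i _ => ?_
    rw [Real.norm_eq_abs, sq_abs]
    congr 1
    simp [PiLp.inner_apply, toLpLin_apply, mulVec, dotProduct, mul_comm]
  simp only [h1, h2]
  conv_rhs => rw [Finset.sum_comm]
  refine Finset.sum_congr rfl fun i _ => ?_
  have h3 : ‖WithLp.toLp 2 (A i)‖ ^ 2 = ∑ j, inner ℝ (WithLp.toLp 2 (A i)) (b j) ^ 2 := by
    rw [norm_sq_eq_sum_inner_sq b]
    exact Finset.sum_congr rfl fun j _ => by rw [real_inner_comm]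
  rw [← h3, EuclideanSpace.norm_sq_eq]
  simp

theorem frobNorm_eq_norm (A : Matrix (Fin n) (Fin n) ℝ) :
    frobNorm A = ‖WithLp.toLp 2 fun p : Fin n × Fin n => A p.1 p.2‖ := by
  rw [EuclideanSpace.norm_eq, frobNorm, Fintype.sum_prod_type]
  simp

theorem frobNorm_add_le (A B : Matrix (Fin n) (Fin n) ℝ) :
    frobNorm (A + B) ≤ frobNorm A + frobNorm B := by
  simp only [frobNorm_eq_norm]
  exact norm_add_le (WithLp.toLp 2 fun p : Fin n × Fin n => A p.1 p.2)
    (WithLp.toLp 2 fun p : Fin n × Fin n => B p.1 p.2)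

theorem IsDiagIn.frobNorm_sq (hA : IsDiagIn b μ A) : frobNorm A ^ 2 = ∑ i, μ i ^ 2 := by
  rw [_root_.frobNorm_sq b]
  refine Finset.sum_congr rfl fun i _ => ?_
  rw [hA i, norm_smul, b.norm_eq_one, mul_one, Real.norm_eq_abs, sq_abs]

theorem specNorm_nonneg (A : Matrix (Fin n) (Fin n) ℝ) : 0 ≤ specNorm A := norm_nonneg _

theorem norm_apply_le_specNorm (A : Matrix (Fin n) (Fin n) ℝ) (v : EuclideanSpace ℝ (Fin n)) :
    ‖toEuclideanLin A v‖ ≤ specNorm A * ‖v‖ :=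
  (Matrix.toEuclideanCLM (n := Fin n) (𝕜 := ℝ) A).le_opNorm v

theorem specNorm_le {c : ℝ} (hc : 0 ≤ c) (h : ∀ v, ‖toEuclideanLin A v‖ ≤ c * ‖v‖) :
    specNorm A ≤ c :=
  ContinuousLinearMap.opNorm_le_bound _ hc h

theorem frobNorm_mul_le (A B : Matrix (Fin n) (Fin n) ℝ) :
    frobNorm (A * B) ≤ specNorm A * frobNorm B := by
  refine abs_le_of_sq_le_sq' ?_ (mul_nonneg (specNorm_nonneg A) (frobNorm_nonneg B)) |>.2
  let b := EuclideanSpace.basisFun (Fin n) ℝ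
  rw [mul_pow, frobNorm_sq b, frobNorm_sq b, Finset.mul_sum]
  refine Finset.sum_le_sum fun i _ => ?_
  rw [toEuclideanLin_mul_apply, ← mul_pow]
  exact pow_le_pow_left₀ (norm_nonneg _) (norm_apply_le_specNorm A _) 2

theorem IsDiagIn.abs_le_specNorm (hA : IsDiagIn b μ A) (i : Fin n) : |μ i| ≤ specNorm A := by
  have := norm_apply_le_specNorm A (b i)
  rwa [hA i, norm_smul, b.norm_eq_one, mul_one, mul_one] at this

theorem IsDiagIn.specNorm_le (hA : IsDiagIn b μ A) {c : ℝ} (hc : 0 ≤ c) (h : ∀ i, |μ i| ≤ c) :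
    specNorm A ≤ c := by
  refine _root_.specNorm_le hc fun v => ?_
  refine abs_le_of_sq_le_sq' ?_ (by positivity) |>.2
  rw [hA.norm_sq_apply, mul_pow, norm_sq_eq_sum_inner_sq b v, Finset.mul_sum]
  refine Finset.sum_le_sum fun i _ => mul_le_mul_of_nonneg_right ?_ (sq_nonneg _)
  exact sq_le_sq' (abs_le.1 (h i)).1 (abs_le.1 (h i)).2

/-- An orthonormal basis of right singular vectors. -/
theorem exists_singular_basis (A : Matrix (Fin n) (Fin n) ℝ) :
    ∃ u : OrthonormalBasis (Fin n) ℝ (EuclideanSpace ℝ (Fin n)), ∀ i : Fin n,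
      (toEuclideanLin A).adjoint (toEuclideanLin A (u i))
        = (toEuclideanLin A).singularValues i ^ 2 • u i := by
  have hn : Module.finrank ℝ (EuclideanSpace ℝ (Fin n)) = n := finrank_euclideanSpace_fin
  refine ⟨(toEuclideanLin A).isSymmetric_adjoint_comp_self.eigenvectorBasis hn, fun i => ?_⟩
  rw [LinearMap.sq_singularValues_fin _ hn]
  exact (toEuclideanLin A).isSymmetric_adjoint_comp_self.apply_eigenvectorBasis hn i

theorem nuclearNorm_eq_sum_fin (A : Matrix (Fin n) (Fin n) ℝ) :
    nuclearNorm A = ∑ i : Fin n, (toEuclideanLin A).singularValues i :=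
  Finset.sum_range _

/-- In a basis of right singular vectors, `⟨u i, A (u i)⟩ ≤ ‖A (u i)‖ = σ i`. No symmetry is needed,
so this applies to a best approximation before its structure is known. -/
theorem trace_le_nuclearNorm (A : Matrix (Fin n) (Fin n) ℝ) :
    LinearMap.trace ℝ _ (toEuclideanLin A) ≤ nuclearNorm A := by
  obtain ⟨u, hu⟩ := exists_singular_basis A
  rw [LinearMap.trace_eq_sum_inner _ u, nuclearNorm_eq_sum_fin]
  refine Finset.sum_le_sum fun i _ => ?_
  have h1 : ‖toEuclideanLin A (u i)‖ ^ 2 = (toEuclideanLin A).singularValues i ^ 2 := by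
    rw [← real_inner_self_eq_norm_sq, ← LinearMap.adjoint_inner_left, hu i, inner_smul_left,
      u.inner_eq_one]
    simp
  have h2 := abs_le_of_sq_le_sq' h1.le (LinearMap.singularValues_nonneg _ _) |>.2
  have h3 := real_inner_le_norm (u i) (toEuclideanLin A (u i))
  rw [u.norm_eq_one, one_mul] at h3
  exact h3.trans h2

theorem IsDiagIn.nuclearNorm (hA : IsDiagIn b μ A) (hμ : ∀ i, 0 ≤ μ i) :
    nuclearNorm A = ∑ i, μ i := by
  obtain ⟨u, hu⟩ := exists_singular_basis A
  rw [← hA.trace, LinearMap.trace_eq_sum_inner _ u, nuclearNorm_eq_sum_fin]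
  refine Finset.sum_congr rfl fun i _ => ?_
  set σ := (toEuclideanLin A).singularValues i with hσ
  have hσ0 : 0 ≤ σ := LinearMap.singularValues_nonneg _ _
  -- Comparing coordinates in `A² u = σ² u` gives `(μ j - σ) (μ j + σ) ⟨b j, u⟩ = 0`; as `μ` and `σ`
  -- are nonnegative, `A u = σ u`. The nuclear norm thus becomes the trace, with no need to match
  -- the sorted singular values with `μ`.
  have key : toEuclideanLin A (u i) = σ • u i := by
    apply b.repr.injective
    ext j
    rw [b.repr_apply_apply, b.repr_apply_apply]
    have h := congrArg (inner ℝ (b j)) (hu i)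
    rw [LinearMap.adjoint_inner_right, hA j, inner_smul_left, inner_smul_right,
      hA.inner_apply] at h
    rw [hA.inner_apply, inner_smul_right]
    simp only [conj_trivial] at h
    have h' : (μ j - σ) * ((μ j + σ) * inner ℝ (b j) (u i)) = 0 := by linear_combination h
    rcases mul_eq_zero.1 h' with h0 | h0
    · rw [sub_eq_zero.1 h0]
    · rcases mul_eq_zero.1 h0 with h1 | h1
      · have := hμ j
        rw [show μ j = 0 by linarith, show σ = 0 by linarith]
      · rw [h1]; ring
  rw [key, inner_smul_right, u.inner_eq_one, mul_one]

theorem IsDiagIn.effRank (hA : IsDiagIn b μ A) (hμ : ∀ i, 0 ≤ μ i) (i₀ : Fin n)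
    (hmax : ∀ i, μ i ≤ μ i₀) : effRank A = (∑ i, μ i) / μ i₀ := by
  have : specNorm A = μ i₀ := by
    apply le_antisymm
    · exact hA.specNorm_le (hμ i₀) fun i => by rw [abs_of_nonneg (hμ i)]; exact hmax i
    · exact (le_abs_self _).trans (hA.abs_le_specNorm i₀)
  rw [_root_.effRank, hA.nuclearNorm hμ, this]

/-! ### The eigenbasis in decreasing order -/

theorem eig_succ (hA : A.IsHermitian) (i : Fin n) :
    eig hA (i + 1) = hA.eigenvalues₀ (finCongr (Fintype.card_fin n).symm i) := by
  have h : 1 ≤ (i : ℕ) + 1 ∧ (i : ℕ) + 1 ≤ n := ⟨by omega, i.2⟩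
  rw [eig, dif_pos h]
  rfl

theorem eig_antitone (hA : A.IsHermitian) : Antitone fun i : Fin n => eig hA (i + 1) := by
  intro i j hij
  simp only [eig_succ]
  exact hA.eigenvalues₀_antitone (by simpa using hij)

theorem exists_eig_basis (hA : A.IsHermitian) :
    ∃ b : OrthonormalBasis (Fin n) ℝ (EuclideanSpace ℝ (Fin n)),
      IsDiagIn b (fun i => eig hA (i + 1)) A := by
  refine ⟨((isSymmetric_toEuclideanLin_iff.mpr hA).eigenvectorBasis
    finrank_euclideanSpace).reindex (finCongr (Fintype.card_fin n)), fun i => ?_⟩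
  simp only [eig_succ, OrthonormalBasis.reindex_apply]
  exact (isSymmetric_toEuclideanLin_iff.mpr hA).apply_eigenvectorBasis finrank_euclideanSpace _

end Diag

/-! ## Best low-rank approximations -/

section BestApprox

variable {n L : ℕ} {b : OrthonormalBasis (Fin n) ℝ (EuclideanSpace ℝ (Fin n))} {μ : Fin n → ℝ}
  {A B : Matrix (Fin n) (Fin n) ℝ}

theorem rank_eq_finrank_range_toEuclideanLin (A : Matrix (Fin n) (Fin n) ℝ) :
    A.rank = Module.finrank ℝ (LinearMap.range (toEuclideanLin A)) := by
  rw [A.rank_eq_finrank_range_toLin (PiLp.basisFun 2 ℝ (Fin n)) (PiLp.basisFun 2 ℝ (Fin n)),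
    toEuclideanLin, toLpLin_eq_toLin]

/-- The indicator of the first `L` indices. -/
def headInd (L : ℕ) {n : ℕ} (i : Fin n) : ℝ := if (i : ℕ) < L then 1 else 0

theorem headInd_of_lt {i : Fin n} (h : (i : ℕ) < L) : headInd L i = 1 := if_pos h

theorem headInd_of_le {i : Fin n} (h : L ≤ (i : ℕ)) : headInd L i = 0 := if_neg (by omega)

theorem sum_headInd (hL : L ≤ n) : ∑ i : Fin n, headInd L i = L := by
  unfold headInd
  rw [Finset.sum_boole, Fin.card_filter_val_lt, min_eq_right hL]

theorem rank_diagMat_le (hL : L ≤ n) (b : OrthonormalBasis (Fin n) ℝ (EuclideanSpace ℝ (Fin n)))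
    (μ : Fin n → ℝ) : (diagMat b fun i => headInd L i * μ i).rank ≤ L := by
  set S := (Finset.univ.filter fun i : Fin n => (i : ℕ) < L).image b with hS
  have hcard : S.card ≤ L := by
    refine Finset.card_image_le.trans ?_
    rw [Fin.card_filter_val_lt, min_eq_right hL]
  rw [rank_eq_finrank_range_toEuclideanLin]
  have hle : LinearMap.range (toEuclideanLin (diagMat b fun i => headInd L i * μ i))
      ≤ Submodule.span ℝ (S : Set (EuclideanSpace ℝ (Fin n))) := by
    rintro _ ⟨v, rfl⟩
    rw [← b.sum_repr v]
    simp only [map_sum, map_smul, isDiagIn_diagMat _ _ _]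
    refine Submodule.sum_mem _ fun i _ => Submodule.smul_mem _ _ ?_
    by_cases h : (i : ℕ) < L
    · exact Submodule.smul_mem _ _ (Submodule.subset_span (by
        simp only [hS, Finset.coe_image, Finset.coe_filter, Finset.mem_univ, true_and]
        exact ⟨i, h, rfl⟩))
    · rw [headInd_of_le (by omega), zero_mul, zero_smul]
      exact Submodule.zero_mem _
  exact (Submodule.finrank_mono hle).trans ((finrank_span_finset_le_card S).trans hcard)

/-- A best approximation is the compression of the matrix to its own range. -/
theorem IsBestRankApprox.apply_eq (hB : IsBestRankApprox L A B) (v : EuclideanSpace ℝ (Fin n)) :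
    toEuclideanLin B v
      = (LinearMap.range (toEuclideanLin B)).starProjection (toEuclideanLin A v) := by
  set K := LinearMap.range (toEuclideanLin B) with hK
  set C : Matrix (Fin n) (Fin n) ℝ :=
    toEuclideanLin.symm ((K.starProjection : _ →ₗ[ℝ] _) ∘ₗ toEuclideanLin A) with hC
  have hCa : ∀ v, toEuclideanLin C v = K.starProjection (toEuclideanLin A v) := by
    intro v
    rw [hC, LinearEquiv.apply_symm_apply]
    rfl
  have hCr : C.rank ≤ L := by
    refine le_trans ?_ hB.1
    rw [rank_eq_finrank_range_toEuclideanLin, rank_eq_finrank_range_toEuclideanLin]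
    refine Submodule.finrank_mono ?_
    rintro _ ⟨v, rfl⟩
    rw [hCa]
    exact Submodule.starProjection_apply_mem _ _
  let e := EuclideanSpace.basisFun (Fin n) ℝ
  have h1 := pow_le_pow_left₀ (frobNorm_nonneg _) (hB.2 C hCr) 2
  -- Projecting `A` onto the range of `B` does not increase the rank, and by Pythagoras it is
  -- strictly closer to `A` unless it equals `B`.
  have hpyth : ∀ v, ‖toEuclideanLin (A - B) v‖ ^ 2
      = ‖toEuclideanLin (A - C) v‖ ^ 2 + ‖toEuclideanLin C v - toEuclideanLin B v‖ ^ 2 := by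
    intro v
    have hmem : toEuclideanLin C v - toEuclideanLin B v ∈ K := by
      rw [hCa]
      exact K.sub_mem (Submodule.starProjection_apply_mem _ _) ⟨v, rfl⟩
    have h := Submodule.starProjection_inner_eq_zero (K := K) (toEuclideanLin A v) _ hmem
    rw [← hCa] at h
    have e1 : toEuclideanLin (A - B) v = toEuclideanLin (A - C) v
        + (toEuclideanLin C v - toEuclideanLin B v) := by
      simp only [map_sub, LinearMap.sub_apply]
      abel
    rw [e1]
    have h' : inner ℝ (toEuclideanLin (A - C) v) (toEuclideanLin C v - toEuclideanLin B v) = 0 := by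
      simpa only [map_sub, LinearMap.sub_apply] using h
    have := norm_add_sq_eq_norm_sq_add_norm_sq_real h'
    simpa only [sq] using this
  rw [frobNorm_sq e, frobNorm_sq e] at h1
  simp only [hpyth, Finset.sum_add_distrib] at h1
  have h2 : ∑ i, ‖toEuclideanLin C (e i) - toEuclideanLin B (e i)‖ ^ 2 = 0 :=
    le_antisymm (by linarith) (Finset.sum_nonneg fun i _ => sq_nonneg _)
  rw [Finset.sum_eq_zero_iff_of_nonneg fun i _ => sq_nonneg _] at h2
  have h3 : B = C := matrix_ext_basis e fun i => by
    have := h2 i (Finset.mem_univ i)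
    rw [sq_eq_zero_iff, norm_eq_zero, sub_eq_zero] at this
    exact this.symm
  rw [← hCa, ← h3]

/-- The diagonal of the projection onto the range of a best approximation. -/
noncomputable def rangeWeight (b : OrthonormalBasis (Fin n) ℝ (EuclideanSpace ℝ (Fin n)))
    (B : Matrix (Fin n) (Fin n) ℝ) (i : Fin n) : ℝ :=
  ‖(LinearMap.range (toEuclideanLin B)).starProjection (b i)‖ ^ 2

theorem rangeWeight_eq_inner (i : Fin n) : rangeWeight b B i
    = inner ℝ (b i) ((LinearMap.range (toEuclideanLin B)).starProjection (b i)) := by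
  have := Submodule.re_inner_starProjection_eq_normSq
    (LinearMap.range (toEuclideanLin B)) (b i)
  rw [rangeWeight, real_inner_comm]
  simpa using this.symm

theorem rangeWeight_nonneg (i : Fin n) : 0 ≤ rangeWeight b B i := sq_nonneg _

theorem rangeWeight_le_one (i : Fin n) : rangeWeight b B i ≤ 1 := by
  have := Submodule.norm_starProjection_apply_le (LinearMap.range (toEuclideanLin B)) (b i)
  rw [b.norm_eq_one] at this
  exact pow_le_one₀ (norm_nonneg _) this

/-- The trace of a projection is the dimension of its range. -/
theorem sum_rangeWeight : ∑ i, rangeWeight b B i = B.rank := by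
  have h : LinearMap.IsProj (LinearMap.range (toEuclideanLin B))
      ((LinearMap.range (toEuclideanLin B)).starProjection : _ →ₗ[ℝ] _) :=
    ⟨fun v => Submodule.starProjection_apply_mem _ v,
      fun v hv => Submodule.starProjection_eq_self_iff.2 hv⟩
  have h1 := h.trace
  rw [LinearMap.trace_eq_sum_inner _ b] at h1
  rw [rank_eq_finrank_range_toEuclideanLin, ← h1]
  exact Finset.sum_congr rfl fun i _ => rangeWeight_eq_inner i

/-- The truncated spectral decomposition is a competitor of rank at most `L`; both squared errors
are written as weighted sums of `μ i ^ 2`. -/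
theorem IsBestRankApprox.sum_le (hB : IsBestRankApprox L A B) (hL : L ≤ n)
    (hA : IsDiagIn b μ A) : ∑ i, μ i ^ 2 * (headInd L i - rangeWeight b B i) ≤ 0 := by
  have h := pow_le_pow_left₀ (frobNorm_nonneg _) (hB.2 _ (rank_diagMat_le hL b μ)) 2
  rw [(hA.sub (isDiagIn_diagMat b _)).frobNorm_sq, frobNorm_sq b] at h
  have h1 : ∀ i, ‖toEuclideanLin (A - B) (b i)‖ ^ 2 = μ i ^ 2 * (1 - rangeWeight b B i) := by
    intro i
    set K := LinearMap.range (toEuclideanLin B) with hK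
    have e1 : toEuclideanLin (A - B) (b i) = μ i • (b i - K.starProjection (b i)) := by
      rw [map_sub, LinearMap.sub_apply, hB.apply_eq, hA i, map_smul, smul_sub]
    have h2 := Submodule.starProjection_inner_eq_zero (K := K) (b i) _
      (Submodule.starProjection_apply_mem K (b i))
    have h3 := norm_add_sq_eq_norm_sq_add_norm_sq_real h2
    rw [sub_add_cancel, b.norm_eq_one] at h3
    rw [e1, norm_smul, mul_pow, Real.norm_eq_abs, sq_abs]
    congr 1
    change _ = 1 - ‖K.starProjection (b i)‖ ^ 2
    linarith
  have h2 : ∀ i, (μ i - headInd L i * μ i) ^ 2 = μ i ^ 2 * (1 - headInd L i) := by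
    intro i
    unfold headInd
    split_ifs <;> ring
  simp only [h1, h2] at h
  have : ∑ i, μ i ^ 2 * (headInd L i - rangeWeight b B i)
      = ∑ i, μ i ^ 2 * (1 - rangeWeight b B i) - ∑ i, μ i ^ 2 * (1 - headInd L i) := by
    rw [← Finset.sum_sub_distrib]
    exact Finset.sum_congr rfl fun i _ => by ring
  linarith

/-- The projection onto the range of a best approximation differs from the leading spectral
projection only inside the eigenspace of the `L`-th eigenvalue. -/
theorem IsBestRankApprox.weights (hB : IsBestRankApprox L A B) (hL : L ≤ n)
    (hA : IsDiagIn b μ A) (hμ : Antitone μ) (hμ0 : ∀ i, 0 ≤ μ i) (l : Fin n)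
    (hl : (l : ℕ) + 1 = L) :
    (∀ i, (μ i - μ l) * (headInd L i - rangeWeight b B i) = 0) ∧
      μ l * ∑ i, (headInd L i - rangeWeight b B i) = 0 := by
  have h1 := hB.sum_le hL hA
  have hterm : ∀ i, 0 ≤ (μ i - μ l) * (headInd L i - rangeWeight b B i) := by
    intro i
    by_cases h : (i : ℕ) < L
    · rw [headInd_of_lt h]
      have : i ≤ l := by rw [Fin.le_def]; omega
      exact mul_nonneg (sub_nonneg.2 (hμ this)) (sub_nonneg.2 (rangeWeight_le_one i))
    · rw [headInd_of_le (by omega)]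
      have : l ≤ i := by rw [Fin.le_def]; omega
      exact mul_nonneg_of_nonpos_of_nonpos (sub_nonpos.2 (hμ this))
        (by linarith [rangeWeight_nonneg (b := b) (B := B) i])
  have hsum : 0 ≤ ∑ i, (headInd L i - rangeWeight b B i) := by
    rw [Finset.sum_sub_distrib, sum_headInd hL, sum_rangeWeight, sub_nonneg]
    exact_mod_cast hB.1
  -- Writing `μ i ^ 2 = (μ i + μ l) (μ i - μ l) + μ l ^ 2` expresses a nonpositive sum as a sum of
  -- nonnegative terms, so each of them vanishes.
  have e : ∑ i, μ i ^ 2 * (headInd L i - rangeWeight b B i)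
      = ∑ i, (μ i + μ l) * ((μ i - μ l) * (headInd L i - rangeWeight b B i))
        + μ l * (μ l * ∑ i, (headInd L i - rangeWeight b B i)) := by
    rw [Finset.mul_sum, Finset.mul_sum, ← Finset.sum_add_distrib]
    exact Finset.sum_congr rfl fun i _ => by ring
  have t1 : ∀ i ∈ Finset.univ,
      0 ≤ (μ i + μ l) * ((μ i - μ l) * (headInd L i - rangeWeight b B i)) :=
    fun i _ => mul_nonneg (add_nonneg (hμ0 i) (hμ0 l)) (hterm i)
  have t2 : 0 ≤ μ l * (μ l * ∑ i, (headInd L i - rangeWeight b B i)) :=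
    mul_nonneg (hμ0 l) (mul_nonneg (hμ0 l) hsum)
  have t3 := Finset.sum_nonneg t1
  constructor
  · intro i
    have h2 := (Finset.sum_eq_zero_iff_of_nonneg t1).1 (by linarith) i (Finset.mem_univ i)
    rcases mul_eq_zero.1 h2 with h | h
    · have := hμ0 i
      have := hμ0 l
      rw [show μ i = 0 by linarith, show μ l = 0 by linarith]
      ring
    · exact h
  · have h2 : μ l * (μ l * ∑ i, (headInd L i - rangeWeight b B i)) = 0 := by linarith
    rcases mul_eq_zero.1 h2 with h | h
    · rw [h, zero_mul]
    · exact h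

theorem IsBestRankApprox.trace (hB : IsBestRankApprox L A B) (hL : L ≤ n)
    (hA : IsDiagIn b μ A) (hμ : Antitone μ) (hμ0 : ∀ i, 0 ≤ μ i) (l : Fin n)
    (hl : (l : ℕ) + 1 = L) :
    LinearMap.trace ℝ _ (toEuclideanLin B) = ∑ i, headInd L i * μ i := by
  obtain ⟨h1, h2⟩ := hB.weights hL hA hμ hμ0 l hl
  have h3 : LinearMap.trace ℝ _ (toEuclideanLin B) = ∑ i, μ i * rangeWeight b B i := by
    rw [LinearMap.trace_eq_sum_inner _ b]
    refine Finset.sum_congr rfl fun i _ => ?_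
    rw [hB.apply_eq, hA i, map_smul, inner_smul_right, rangeWeight_eq_inner]
  have h4 : ∑ i, (headInd L i * μ i - μ i * rangeWeight b B i) = 0 := by
    rw [← h2, Finset.mul_sum]
    exact Finset.sum_congr rfl fun i _ => by linarith [h1 i]
  rw [Finset.sum_sub_distrib] at h4
  rw [h3]
  linarith

theorem IsBestRankApprox.specNorm_le (hB : IsBestRankApprox L A B) : specNorm B ≤ specNorm A := by
  refine _root_.specNorm_le (specNorm_nonneg A) fun v => ?_
  rw [hB.apply_eq]
  exact (Submodule.norm_starProjection_apply_le _ _).trans (norm_apply_le_specNorm A v)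

/-- The trace bounds the nuclear norm from below and compression does not increase the spectral
norm. No gap is assumed, so repeated eigenvalues are allowed. -/
theorem IsBestRankApprox.le_effRank (hB : IsBestRankApprox L A B) (hL : L ≤ n)
    (hA : IsDiagIn b μ A) (hμ : Antitone μ) (hμ0 : ∀ i, 0 ≤ μ i) (l : Fin n)
    (hl : (l : ℕ) + 1 = L) (hμl : 0 < μ l) (i₀ : Fin n) (hi₀ : ∀ i, μ i ≤ μ i₀) :
    (∑ i, headInd L i * μ i) / μ i₀ ≤ effRank B := by
  have h1 := trace_le_nuclearNorm B
  have htr := hB.trace hL hA hμ hμ0 l hl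
  rw [htr] at h1
  have h2 : specNorm B ≤ μ i₀ := hB.specNorm_le.trans
    (hA.specNorm_le (hμ0 i₀) fun i => by rw [abs_of_nonneg (hμ0 i)]; exact hi₀ i)
  have hnn : ∀ i ∈ Finset.univ, 0 ≤ headInd L i * μ i := fun i _ => by
    unfold headInd
    split_ifs <;> simp [hμ0 i]
  have hpos : 0 < ∑ i, headInd L i * μ i := by
    refine Finset.sum_pos' hnn ⟨l, Finset.mem_univ l, ?_⟩
    rw [headInd_of_lt (by omega), one_mul]
    exact hμl
  -- Needed because a quotient by zero would be `0`; the positive trace excludes `B = 0`.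
  have h3 : 0 < specNorm B := by
    refine lt_of_le_of_ne (specNorm_nonneg B) fun h => ?_
    have hz : toEuclideanLin B = 0 := by
      ext1 v
      have := norm_apply_le_specNorm B v
      rw [← h, zero_mul] at this
      simpa using this
    rw [hz, map_zero] at htr
    exact hpos.ne htr
  unfold effRank
  exact div_le_div₀ (hpos.le.trans h1) h1 h3 h2

/-- With a spectral gap the best approximation is the truncated spectral decomposition. -/
theorem IsBestRankApprox.isDiagIn (hB : IsBestRankApprox L A B) (hL : L ≤ n)
    (hA : IsDiagIn b μ A) (hμ : Antitone μ) (hμ0 : ∀ i, 0 ≤ μ i) (l : Fin n)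
    (hl : (l : ℕ) + 1 = L) (hgap : ∀ i : Fin n, L ≤ i → μ i < μ l) :
    IsDiagIn b (fun i => headInd L i * μ i) B := by
  obtain ⟨h1, h2⟩ := hB.weights hL hA hμ hμ0 l hl
  have htail : ∀ i : Fin n, L ≤ i → rangeWeight b B i = 0 := by
    intro i hi
    have := h1 i
    rw [headInd_of_le hi] at this
    rcases mul_eq_zero.1 this with h | h
    · linarith [hgap i hi]
    · linarith
  have hhead : ∀ i : Fin n, (i : ℕ) < L → μ i = 0 ∨ rangeWeight b B i = 1 := by
    intro i hi
    rcases (hμ0 l).eq_or_lt with h0 | h0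
    · have := h1 i
      rw [headInd_of_lt hi, ← h0, sub_zero] at this
      rcases mul_eq_zero.1 this with h | h
      · exact Or.inl h
      · right; linarith
    · right
      have h3 := (mul_eq_zero.1 h2).resolve_left h0.ne'
      have t : ∀ j ∈ Finset.univ, 0 ≤ headInd L j - rangeWeight b B j := by
        intro j _
        by_cases hj : (j : ℕ) < L
        · rw [headInd_of_lt hj]; exact sub_nonneg.2 (rangeWeight_le_one j)
        · rw [headInd_of_le (by omega), htail j (by omega), sub_zero]
      have := (Finset.sum_eq_zero_iff_of_nonneg t).1 h3 i (Finset.mem_univ i)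
      rw [headInd_of_lt hi] at this
      linarith
  intro i
  rw [hB.apply_eq, hA i, map_smul]
  beta_reduce
  by_cases hi : (i : ℕ) < L
  · rw [headInd_of_lt hi, one_mul]
    rcases hhead i hi with h | h
    · rw [h, zero_smul, zero_smul]
    · have h4 : ‖(LinearMap.range (toEuclideanLin B)).starProjection (b i)‖ = ‖b i‖ := by
        rw [b.norm_eq_one]
        exact (pow_eq_one_iff_of_nonneg (norm_nonneg _) two_ne_zero).1 h
      have := (Submodule.mem_iff_norm_starProjection _ _).2 h4
      rw [Submodule.starProjection_eq_self_iff.2 this]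
  · have h := htail i (by omega)
    rw [rangeWeight, sq_eq_zero_iff, norm_eq_zero] at h
    rw [h, headInd_of_le (by omega), smul_zero, zero_mul, zero_smul]

end BestApprox

/-! ## Perturbation of eigenvalues and spectral projections -/

section Perturbation

variable {n : ℕ} {b b' : OrthonormalBasis (Fin n) ℝ (EuclideanSpace ℝ (Fin n))}
  {μ μ' : Fin n → ℝ} {A A' : Matrix (Fin n) (Fin n) ℝ}

theorem IsDiagIn.inner_self (hA : IsDiagIn b μ A) (v : EuclideanSpace ℝ (Fin n)) :
    inner ℝ v (toEuclideanLin A v) = ∑ i, μ i * inner ℝ (b i) v ^ 2 := by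
  rw [← b.sum_inner_mul_inner]
  refine Finset.sum_congr rfl fun i _ => ?_
  rw [hA.inner_apply, real_inner_comm]
  ring

/-- Weyl's inequality. -/
theorem IsDiagIn.weyl (hA : IsDiagIn b μ A) (hA' : IsDiagIn b' μ' A') (hμ : Antitone μ)
    (hμ' : Antitone μ') (i : Fin n) : μ' i ≤ μ i + specNorm (A' - A) := by
  -- The `i`-th coordinate of `Φ` is zero, so `Φ` has a nonzero kernel vector, orthogonal to `b j`
  -- for `j < i` and to `b' j` for `j > i`. Its quadratic forms compare `μ i` with `μ' i`.
  let Φ : EuclideanSpace ℝ (Fin n) →ₗ[ℝ] (Fin n → ℝ) := LinearMap.pi fun j =>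
    if j < i then innerₗ _ (b j) else if i < j then innerₗ _ (b' j) else 0
  have hΦ : ¬ Function.Surjective Φ := by
    intro h
    obtain ⟨v, hv⟩ := h (Pi.single i 1)
    have := congrFun hv i
    simp [Φ] at this
  have hΦ' : ¬ Function.Injective Φ := fun h => hΦ
    ((LinearMap.injective_iff_surjective_of_finrank_eq_finrank (by simp)).1 h)
  rw [injective_iff_map_eq_zero] at hΦ'
  push Not at hΦ'
  obtain ⟨v, hv, hv0⟩ := hΦ'
  have h1 : ∀ j, j < i → inner ℝ (b j) v = 0 := by
    intro j hj
    have := congrFun hv j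
    simpa [Φ, hj] using this
  have h2 : ∀ j, i < j → inner ℝ (b' j) v = 0 := by
    intro j hj
    have := congrFun hv j
    simpa [Φ, hj, hj.not_gt] using this
  have h3 : inner ℝ v (toEuclideanLin A v) ≤ μ i * ‖v‖ ^ 2 := by
    rw [hA.inner_self, norm_sq_eq_sum_inner_sq b v, Finset.mul_sum]
    refine Finset.sum_le_sum fun j _ => ?_
    rcases lt_or_ge j i with h | h
    · simp [h1 j h]
    · exact mul_le_mul_of_nonneg_right (hμ h) (sq_nonneg _)
  have h4 : μ' i * ‖v‖ ^ 2 ≤ inner ℝ v (toEuclideanLin A' v) := by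
    rw [hA'.inner_self, norm_sq_eq_sum_inner_sq b' v, Finset.mul_sum]
    refine Finset.sum_le_sum fun j _ => ?_
    rcases lt_or_ge i j with h | h
    · simp [h2 j h]
    · exact mul_le_mul_of_nonneg_right (hμ' h) (sq_nonneg _)
  have h5 : inner ℝ v (toEuclideanLin (A' - A) v) ≤ specNorm (A' - A) * ‖v‖ ^ 2 := by
    refine (real_inner_le_norm _ _).trans ?_
    have := mul_le_mul_of_nonneg_left (norm_apply_le_specNorm (A' - A) v) (norm_nonneg v)
    linarith
  rw [map_sub, LinearMap.sub_apply, inner_sub_right] at h5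
  have hvp : 0 < ‖v‖ ^ 2 := by positivity
  by_contra! hcon
  nlinarith

theorem specNorm_sub_comm (A B : Matrix (Fin n) (Fin n) ℝ) : specNorm (A - B) = specNorm (B - A) := by
  unfold specNorm
  rw [← neg_sub, map_neg, norm_neg]

theorem IsDiagIn.abs_sub_le (hA : IsDiagIn b μ A) (hA' : IsDiagIn b' μ' A') (hμ : Antitone μ)
    (hμ' : Antitone μ') (i : Fin n) : |μ' i - μ i| ≤ specNorm (A' - A) := by
  have h1 := hA.weyl hA' hμ hμ' i
  have h2 := hA'.weyl hA hμ' hμ i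
  rw [specNorm_sub_comm] at h2
  rw [abs_le]
  constructor <;> linarith

variable {L : ℕ}

theorem headInd_sq (i : Fin n) : headInd L i ^ 2 = headInd L i := by
  unfold headInd; split_ifs <;> norm_num

theorem headInd_nonneg (i : Fin n) : 0 ≤ headInd L i := by
  unfold headInd; split_ifs <;> norm_num

theorem headInd_le_one (i : Fin n) : headInd L i ≤ 1 := by
  unfold headInd; split_ifs <;> norm_num

/-- Both projections have rank `L`, so the two off-diagonal blocks of overlaps have equal total
mass; hence the factor `2`. -/
theorem frobNorm_proj_sub_sq (hL : L ≤ n) :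
    frobNorm (diagMat b' (headInd L) - diagMat b (headInd L)) ^ 2
      = 2 * ∑ i, ∑ j, headInd L i * (1 - headInd L j) * inner ℝ (b j) (b' i) ^ 2 := by
  have h1 : ∀ i, ‖toEuclideanLin (diagMat b' (headInd L) - diagMat b (headInd L)) (b' i)‖ ^ 2
      = ∑ j, (headInd L i + headInd L j - 2 * (headInd L i * headInd L j))
          * inner ℝ (b j) (b' i) ^ 2 := by
    intro i
    rw [norm_sq_eq_sum_inner_sq b]
    refine Finset.sum_congr rfl fun j _ => ?_
    rw [map_sub, LinearMap.sub_apply, inner_sub_right, (isDiagIn_diagMat b' _) i,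
      (isDiagIn_diagMat b _).inner_apply, inner_smul_right]
    have a1 := headInd_sq (L := L) i
    have a2 := headInd_sq (L := L) j
    linear_combination inner ℝ (b j) (b' i) ^ 2 * (a1 + a2)
  have hrow : ∑ i, ∑ j, headInd L i * inner ℝ (b j) (b' i) ^ 2 = L := by
    rw [← sum_headInd hL]
    refine Finset.sum_congr rfl fun i _ => ?_
    rw [← Finset.mul_sum, ← norm_sq_eq_sum_inner_sq, b'.norm_eq_one]
    norm_num
  have hcol : ∑ i, ∑ j, headInd L j * inner ℝ (b j) (b' i) ^ 2 = L := by
    rw [Finset.sum_comm, ← sum_headInd hL]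
    refine Finset.sum_congr rfl fun j _ => ?_
    have : ∑ i, inner ℝ (b j) (b' i) ^ 2 = ‖b j‖ ^ 2 := by
      rw [norm_sq_eq_sum_inner_sq b']
      exact Finset.sum_congr rfl fun i _ => by rw [real_inner_comm]
    rw [← Finset.mul_sum, this, b.norm_eq_one]
    norm_num
  rw [frobNorm_sq b']
  simp only [h1, add_mul, sub_mul, mul_sub, mul_one, Finset.sum_sub_distrib,
    Finset.sum_add_distrib, mul_assoc, ← Finset.mul_sum] at hrow hcol ⊢
  rw [hrow, hcol]
  ring

/-- The `sin Θ` theorem for the leading spectral projections. -/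
theorem frobNorm_proj_sub_le (hL : L ≤ n) (hA : IsDiagIn b μ A) (hA' : IsDiagIn b' μ' A')
    (hμ : Antitone μ) (hμ' : Antitone μ') {δ : ℝ} (hδ : 0 < δ)
    (hgap : ∀ i j : Fin n, (i : ℕ) < L → L ≤ (j : ℕ) → δ ≤ μ i - μ j) :
    frobNorm (diagMat b' (headInd L) - diagMat b (headInd L))
      ≤ 2 * Real.sqrt (2 * L) / δ * specNorm (A' - A) := by
  set e := specNorm (A' - A) with he
  have he0 : 0 ≤ e := specNorm_nonneg _
  have hsum : ∀ c : ℝ, (∑ i : Fin n, headInd L i * c) = L * c := fun c => by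
    rw [← Finset.sum_mul, sum_headInd hL]
  have key : ∑ i, ∑ j, headInd L i * (1 - headInd L j) * inner ℝ (b j) (b' i) ^ 2
      ≤ L * (4 / δ ^ 2 * e ^ 2) := by
    rw [← hsum]
    refine Finset.sum_le_sum fun i _ => ?_
    by_cases hi : (i : ℕ) < L
    swap
    · simp [headInd_of_le (show L ≤ (i : ℕ) by omega)]
    rw [headInd_of_lt hi]
    simp only [one_mul]
    -- For `e ≥ δ / 2` the trivial bound `1` suffices. Otherwise Weyl leaves a separation of at
    -- least `δ / 2` in `⟨b j, (A' - A) b' i⟩ = (μ' i - μ j) ⟨b j, b' i⟩`.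
    rcases le_or_gt (δ / 2) e with hbig | hsmall
    · calc ∑ j, (1 - headInd L j) * inner ℝ (b j) (b' i) ^ 2
          ≤ ∑ j, inner ℝ (b j) (b' i) ^ 2 := by
            refine Finset.sum_le_sum fun j _ => ?_
            have := headInd_nonneg (L := L) j
            have := sq_nonneg (inner ℝ (b j) (b' i))
            nlinarith
        _ = 1 := by rw [← norm_sq_eq_sum_inner_sq, b'.norm_eq_one, one_pow]
        _ ≤ 4 / δ ^ 2 * e ^ 2 := by
            rw [div_mul_eq_mul_div, le_div_iff₀ (by positivity)]
            nlinarith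
    · calc ∑ j, (1 - headInd L j) * inner ℝ (b j) (b' i) ^ 2
          ≤ ∑ j, 4 / δ ^ 2 * inner ℝ (b j) (toEuclideanLin (A' - A) (b' i)) ^ 2 := by
            refine Finset.sum_le_sum fun j _ => ?_
            by_cases hj : (j : ℕ) < L
            · rw [headInd_of_lt hj, sub_self, zero_mul]
              positivity
            have hj' : L ≤ (j : ℕ) := by omega
            rw [headInd_of_le hj', sub_zero, one_mul, map_sub, LinearMap.sub_apply,
              inner_sub_right, hA' i, inner_smul_right, hA.inner_apply, ← sub_mul, mul_pow,
              ← mul_assoc]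
            refine le_mul_of_one_le_left (sq_nonneg _) ?_
            have h1 := (abs_le.1 (hA.abs_sub_le hA' hμ hμ' i)).1
            have h2 := hgap i j hi hj'
            have h3 : δ / 2 ≤ μ' i - μ j := by linarith
            have h4 := pow_le_pow_left₀ (by positivity) h3 2
            rw [div_mul_eq_mul_div, le_div_iff₀ (by positivity)]
            linarith
        _ = 4 / δ ^ 2 * ‖toEuclideanLin (A' - A) (b' i)‖ ^ 2 := by
            rw [← Finset.mul_sum, ← norm_sq_eq_sum_inner_sq]
        _ ≤ 4 / δ ^ 2 * e ^ 2 := by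
            have := norm_apply_le_specNorm (A' - A) (b' i)
            rw [b'.norm_eq_one, mul_one] at this
            gcongr
  refine abs_le_of_sq_le_sq' ?_ (by positivity) |>.2
  rw [frobNorm_proj_sub_sq hL, mul_pow, div_pow, mul_pow, Real.sq_sqrt (by positivity)]
  calc _ ≤ 2 * (L * (4 / δ ^ 2 * e ^ 2)) := by gcongr
    _ = _ := by ring

/-- Perturbation of the truncated spectral decomposition. -/
theorem frobNorm_truncation_sub_le (hL : L ≤ n) (hA : IsDiagIn b μ A) (hA' : IsDiagIn b' μ' A')
    (hμ : Antitone μ) (hμ' : Antitone μ') {δ : ℝ} (hδ : 0 < δ)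
    (hgap : ∀ i j : Fin n, (i : ℕ) < L → L ≤ (j : ℕ) → δ ≤ μ i - μ j) :
    frobNorm (diagMat b' (fun i => headInd L i * μ' i) - diagMat b (fun i => headInd L i * μ i))
      ≤ (2 * Real.sqrt (2 * L) / δ * specNorm A + Real.sqrt L) * specNorm (A' - A) := by
  have e1 : diagMat b' (fun i => headInd L i * μ' i) = A' * diagMat b' (headInd L) := by
    refine (isDiagIn_diagMat b' _).eq ?_
    simpa only [mul_comm] using hA'.mul (isDiagIn_diagMat b' (headInd L))
  have e2 : diagMat b (fun i => headInd L i * μ i) = A * diagMat b (headInd L) := by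
    refine (isDiagIn_diagMat b _).eq ?_
    simpa only [mul_comm] using hA.mul (isDiagIn_diagMat b (headInd L))
  have e3 : diagMat b' (fun i => headInd L i * μ' i) - diagMat b (fun i => headInd L i * μ i)
      = (A' - A) * diagMat b' (headInd L)
        + A * (diagMat b' (headInd L) - diagMat b (headInd L)) := by
    rw [e1, e2, sub_mul, mul_sub]
    abel
  have h1 : frobNorm (diagMat b' (headInd L)) = Real.sqrt L := by
    rw [← Real.sqrt_sq (frobNorm_nonneg _), (isDiagIn_diagMat b' _).frobNorm_sq]
    simp only [headInd_sq, sum_headInd hL]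
  have h2 := frobNorm_mul_le (A' - A) (diagMat b' (headInd L))
  have h3 := frobNorm_mul_le A (diagMat b' (headInd L) - diagMat b (headInd L))
  have h4 := mul_le_mul_of_nonneg_left (frobNorm_proj_sub_le hL hA hA' hμ hμ' hδ hgap)
    (specNorm_nonneg A)
  rw [h1] at h2
  rw [e3]
  refine (frobNorm_add_le _ _).trans ?_
  linarith

end Perturbation

/-! ## Reduction of gradient descent to the scalar dynamics -/

section GradientDescent

theorem prod_ofFn_update {M : Type*} [Monoid M] {N : ℕ} (X Y : M) (i : Fin N) :
    (List.ofFn (Function.update (fun _ => X) i Y)).prod = X ^ (i : ℕ) * Y * X ^ (N - 1 - i) := by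
  induction N with
  | zero => exact i.elim0
  | succ N ih =>
    rw [List.ofFn_succ, List.prod_cons]
    refine Fin.cases ?_ (fun i => ?_) i
    · have : (fun j : Fin N => Function.update (fun _ : Fin (N + 1) => X) 0 Y j.succ)
          = fun _ => X := by
        funext j
        exact Function.update_of_ne (Fin.succ_ne_zero j) _ _
      rw [this, Function.update_self, List.ofFn_const, List.prod_replicate]
      simp
    · have : (fun j : Fin N => Function.update (fun _ : Fin (N + 1) => X) i.succ Y j.succ)
          = Function.update (fun _ => X) i Y := by
        funext j
        simp [Function.update_apply]
      rw [this, ih i, Function.update_of_ne (Fin.succ_ne_zero i).symm, Fin.val_succ, pow_succ',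
        mul_assoc, mul_assoc, mul_assoc]
      congr 4
      omega

variable {n N : ℕ} {b : OrthonormalBasis (Fin n) ℝ (EuclideanSpace ℝ (Fin n))}
  {x μ : Fin n → ℝ} {X M : Matrix (Fin n) (Fin n) ℝ}

theorem layerProd_const (X : Matrix (Fin n) (Fin n) ℝ) :
    layerProd (fun _ : Fin N => X) = X ^ N := by
  rw [layerProd, List.ofFn_const, List.prod_replicate]

theorem layerProd_update (X Y : Matrix (Fin n) (Fin n) ℝ) (j : Fin N) :
    layerProd (Function.update (fun _ => X) j Y) = X ^ (j.rev : ℕ) * Y * X ^ (j : ℕ) := by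
  have h : (fun i : Fin N => Function.update (fun _ => X) j Y i.rev)
      = Function.update (fun _ => X) j.rev Y := by
    funext i
    simp only [Function.update_apply, Fin.rev_eq_iff]
  rw [layerProd, h, prod_ofFn_update]
  congr 2
  rw [Fin.val_rev]
  omega

theorem frobNorm_sq_entries (A : Matrix (Fin n) (Fin n) ℝ) :
    frobNorm A ^ 2 = ∑ p, ∑ q, A p q ^ 2 :=
  Real.sq_sqrt (Finset.sum_nonneg fun _ _ => Finset.sum_nonneg fun _ _ => sq_nonneg _)

theorem deriv_half_frobNorm_sq (C D : Matrix (Fin n) (Fin n) ℝ) :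
    deriv (fun t : ℝ => 1 / 2 * frobNorm (C + t • D) ^ 2) 0 = ∑ p, ∑ q, C p q * D p q := by
  have h1 : (fun t : ℝ => 1 / 2 * frobNorm (C + t • D) ^ 2)
      = fun t => 1 / 2 * ∑ p, ∑ q, (C p q + t * D p q) ^ 2 := by
    funext t
    rw [frobNorm_sq_entries]
    simp
  rw [h1]
  apply HasDerivAt.deriv
  have h2 : ∀ p q, HasDerivAt (fun t : ℝ => (C p q + t * D p q) ^ 2) (2 * (C p q * D p q)) 0 := by
    intro p q
    have := (((hasDerivAt_id (0 : ℝ)).mul_const (D p q)).const_add (C p q)).pow 2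
    refine this.congr_deriv ?_
    simp
    ring
  have h3 := (HasDerivAt.fun_sum (u := Finset.univ) fun p _ =>
    HasDerivAt.fun_sum (u := Finset.univ) fun q _ => h2 p q).const_mul (1 / 2 : ℝ)
  refine h3.congr_deriv ?_
  simp only [← Finset.mul_sum]
  ring

theorem sum_mul_single (C P Q : Matrix (Fin n) (Fin n) ℝ) (i j : Fin n) :
    ∑ p, ∑ q, C p q * (P * Matrix.single i j (1 : ℝ) * Q) p q = (Pᵀ * C * Qᵀ) i j := by
  have h : ∀ p q, (P * Matrix.single i j (1 : ℝ) * Q) p q = P p i * Q j q := by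
    intro p q
    rw [Matrix.mul_apply, Finset.sum_eq_single j]
    · simp
    · intro k _ hk
      rw [Matrix.mul_single_apply_of_ne _ _ _ _ _ hk, zero_mul]
    · simp
  simp only [h, Matrix.mul_apply, Matrix.transpose_apply, Finset.sum_mul]
  rw [Finset.sum_comm]
  exact Finset.sum_congr rfl fun q _ => Finset.sum_congr rfl fun p _ => by ring

/-- The gradient is `X^(N-1-j) (X^N - M) X^j`, whose factors are diagonal in the same basis. Its
diagonal does not depend on `j`, so equal factors remain equal. -/
theorem lossGrad_const (hX : IsDiagIn b x X) (hM : IsDiagIn b μ M) (j : Fin N) :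
    IsDiagIn b (fun i => x i ^ (N - 1) * (x i ^ N - μ i)) (lossGrad M (fun _ => X) j) := by
  have hXt : Xᵀ = X := by
    have := hX.isHermitian
    rwa [Matrix.IsHermitian, conjTranspose_eq_transpose_of_trivial] at this
  have hpow : X ^ (j.rev : ℕ) * X * X ^ (j : ℕ) = X ^ N := by
    rw [← pow_succ, ← pow_add]
    congr 1
    rw [Fin.val_rev]
    omega
  have h : lossGrad M (fun _ => X) j = X ^ (j.rev : ℕ) * (X ^ N - M) * X ^ (j : ℕ) := by
    ext p q
    have h1 : (fun t : ℝ => loss M (Function.update (fun _ : Fin N => X) j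
          (X + t • Matrix.single p q (1 : ℝ))))
        = fun t : ℝ => 1 / 2 * frobNorm ((X ^ N - M)
          + t • (X ^ (j.rev : ℕ) * Matrix.single p q (1 : ℝ) * X ^ (j : ℕ))) ^ 2 := by
      funext t
      rw [loss, layerProd_update, mul_add, add_mul, hpow, mul_smul_comm, smul_mul_assoc]
      congr 3
      abel
    rw [lossGrad, Matrix.of_apply, h1, deriv_half_frobNorm_sq, sum_mul_single,
      transpose_pow, transpose_pow, hXt]
  rw [h]
  have h2 := ((hX.pow (j.rev : ℕ)).mul ((hX.pow N).sub hM)).mul (hX.pow (j : ℕ))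
  intro i
  rw [h2 i]
  congr 1
  beta_reduce
  have : x i ^ (N - 1) = x i ^ (j.rev : ℕ) * x i ^ (j : ℕ) := by
    rw [← pow_add]
    congr 1
    rw [Fin.val_rev]
    omega
  rw [this]
  ring

theorem gdIter_eq (hM : IsDiagIn b μ M) (η α : ℝ) (k : ℕ) :
    gdIter (N := N) M η α k = fun _ => diagMat b fun i => gdScalar N η (μ i) α k := by
  induction k with
  | zero =>
    funext j
    refine IsDiagIn.eq (b := b) (μ := fun _ => α) ?_ (isDiagIn_diagMat b _)
    change IsDiagIn b (fun _ => α) (α • 1)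
    simpa using IsDiagIn.one.smul α
  | succ k ih =>
    funext j
    have h := (isDiagIn_diagMat b fun i => gdScalar N η (μ i) α k).sub
      ((lossGrad_const (isDiagIn_diagMat b fun i => gdScalar N η (μ i) α k) hM j).smul η)
    rw [gdIter, ih]
    exact h.eq (isDiagIn_diagMat b _)

theorem isDiagIn_gdProd (hM : IsDiagIn b μ M) (η α : ℝ) (k : ℕ) :
    IsDiagIn b (fun i => gdScalar N η (μ i) α k ^ N) (gdProd N M η α k) := by
  rw [gdProd, gdIter_eq hM, layerProd_const]
  exact (isDiagIn_diagMat b _).pow N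

end GradientDescent

/-! ### The window estimates for the eigenvalues of the product -/

section Window

variable {N k : ℕ} {η β α τ : ℝ}

theorem exists_pow_eq (hN : N ≠ 0) {x : ℝ} (hx : 0 < x) : ∃ s, 0 < s ∧ s ^ N = x :=
  ⟨x ^ (1 / (N : ℝ)), Real.rpow_pos_of_pos hx _, rpow_one_div_pow hN hx.le⟩

theorem gdScalar_pow_mem_of_TId_le (hN : 2 ≤ N) (hη : 0 < η)
    (hb : η * (3 * N - 2) * β ^ (2 * N - 2) ≤ 1) (hα : 0 < α) (hβ : 0 ≤ β) (hτ : 0 < τ)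
    (hτβ : τ ≤ β ^ N) (hατ : α ^ N < cN N * τ) {ε : ℝ} (hε : 0 < ε) (hε1 : ε ≤ 1)
    (hk : TId N τ (τ ^ (1 / (N : ℝ)) / (4 * N) * ε) α η ≤ k) :
    (1 - ε / 4) * τ < gdScalar N η τ α k ^ N ∧ gdScalar N η τ α k ^ N ≤ τ := by
  have hN0 : N ≠ 0 := by omega
  have hc := cN_mem hN
  obtain ⟨s, hs, rfl⟩ := exists_pow_eq hN0 hτ
  have hsβ : s ≤ β := (pow_le_pow_iff_left₀ hs.le hβ hN0).1 hτβ
  have hαs : α ≤ s := by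
    refine (pow_le_pow_iff_left₀ hα.le hs.le hN0).1 (hατ.le.trans ?_)
    nlinarith
  have hlb : -β ^ N ≤ s ^ N := by
    have := pow_nonneg hβ N
    linarith
  obtain ⟨h0, h1⟩ := gdScalar_mem hN hη.le hb hlb le_rfl hsβ hα.le hαs k
  refine ⟨?_, pow_le_pow_left₀ h0 h1 N⟩
  have h2 := le_gdScalar_of_TId_le hN hη hb hα hs hsβ hατ hε hε1 hk
  have h3 := lt_one_sub_div_pow hN hε hε1
  have hNR : (2 : ℝ) ≤ N := by exact_mod_cast hN
  have h4 : 0 ≤ 1 - ε / (4 * N) := by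
    rw [sub_nonneg, div_le_one (by positivity)]
    linarith
  calc (1 - ε / 4) * s ^ N < (1 - ε / (4 * N)) ^ N * s ^ N := by gcongr
    _ = (s * (1 - ε / (4 * N))) ^ N := by rw [mul_pow, mul_comm]
    _ ≤ _ := pow_le_pow_left₀ (by positivity) h2 N

/-- An eigenvalue at most `α ^ N`, possibly negative, keeps the iterate below its start; a larger
one keeps it below its limit. -/
theorem gdScalar_pow_le_max (hN : 2 ≤ N) (hη : 0 < η)
    (hb : η * (3 * N - 2) * β ^ (2 * N - 2) ≤ 1) (hα : 0 < α) (hαβ : α ≤ β)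
    (hlb : -β ^ N ≤ τ) (hτβ : τ ≤ β ^ N) : gdScalar N η τ α k ^ N ≤ max (α ^ N) τ := by
  have hN0 : N ≠ 0 := by omega
  rcases le_total τ (α ^ N) with h | h
  · obtain ⟨h0, h1⟩ := gdScalar_mem hN hη.le hb hlb h hαβ hα.le le_rfl k
    exact (pow_le_pow_left₀ h0 h1 N).trans (le_max_left _ _)
  · obtain ⟨s, hs, rfl⟩ := exists_pow_eq hN0 ((pow_pos hα N).trans_le h)
    have hsβ : s ≤ β := (pow_le_pow_iff_left₀ hs.le (hα.le.trans hαβ) hN0).1 hτβ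
    have hαs : α ≤ s := (pow_le_pow_iff_left₀ hα.le hs.le hN0).1 h
    obtain ⟨h0, h1⟩ := gdScalar_mem hN hη.le hb hlb le_rfl hsβ hα.le hαs k
    exact (pow_le_pow_left₀ h0 h1 N).trans (le_max_right _ _)

/-- The bound on the trailing eigenvalues before the time `T₁`. -/
theorem gdScalar_pow_le_of_window (hN : 2 ≤ N) (hη : 0 < η)
    (hb : η * (3 * N - 2) * β ^ (2 * N - 2) ≤ 1) (hα : 0 < α) (hαβ : α ≤ β)
    (hlb : -β ^ N ≤ τ) {lam : ℝ} (hτ : τ ≤ lam) (hlam : lam ≤ β ^ N) {ε' : ℝ} (hε : 0 < ε')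
    (hε' : ε' < cN N) (hk : α ^ N < lam → (k : ℝ) ≤ Tone N lam ε' α η) :
    gdScalar N η τ α k ^ N ≤ max (α ^ N) (ε' * lam) := by
  have hN0 : N ≠ 0 := by omega
  have hc := cN_mem hN
  have hαN := pow_pos hα N
  rcases le_or_gt lam (α ^ N) with h | h
  · refine (gdScalar_pow_le_max hN hη hb hα hαβ hlb (hτ.trans hlam)).trans ?_
    exact max_le (le_max_left _ _) ((hτ.trans h).trans (le_max_left _ _))
  rcases le_or_gt (ε' * lam) (α ^ N) with h' | h'
  · have h1 := (hk h).trans (Tone_nonpos hN0 hη hα h hε.le h')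
    have h2 : k = 0 := by exact_mod_cast le_antisymm h1 (Nat.cast_nonneg k)
    rw [h2]
    exact le_max_left _ _
  · obtain ⟨s, hs, rfl⟩ := exists_pow_eq hN0 (hαN.trans h)
    have hsβ : s ≤ β := (pow_le_pow_iff_left₀ hs.le (hα.le.trans hαβ) hN0).1 hlam
    have h1 := gdScalar_mono_left hN hη.le hb hτ hlb hlam hα.le hαβ k
    have h2 := (gdScalar_mem hN hη.le hb hlb (hτ.trans hlam) le_rfl hα.le hαβ k).1
    have h3 := gdScalar_pow_le_of_le_Tone hN hη hb hα hs hsβ hε hε'.le h' (hk h)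
    exact ((pow_le_pow_left₀ h2 h1 N).trans h3).trans (le_max_right _ _)

end Window

/-! ### Comparison of quotients of eigenvalue sums -/

section Ratios

variable {n : ℕ}

/-- The difference equals `((a - c) - (c / c₀) (a₀ - c₀)) / a₀`, and `c / c₀ ≤ 1`; the two errors
give the factor `2`. -/
theorem abs_div_sub_div_le {a a₀ c c₀ e : ℝ} (ha₀ : 0 < a₀) (hc₀ : 0 < c₀) (hc : 0 ≤ c)
    (hcc₀ : c ≤ c₀) (h : |a - c| ≤ e) (h₀ : |a₀ - c₀| ≤ e) : |a / a₀ - c / c₀| ≤ 2 * (e / a₀) := by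
  have e1 : a / a₀ - c / c₀ = ((a - c) - c / c₀ * (a₀ - c₀)) / a₀ := by
    field_simp
    ring
  rw [e1, abs_div, abs_of_pos ha₀, ← mul_div_assoc]
  gcongr
  have h1 : 0 ≤ c / c₀ := by positivity
  have h2 : c / c₀ ≤ 1 := (div_le_one hc₀).2 hcc₀
  have h3 : |c / c₀ * (a₀ - c₀)| ≤ e := by
    rw [abs_mul, abs_of_nonneg h1]
    nlinarith [abs_nonneg (a₀ - c₀)]
  have h4 := abs_sub (a - c) (c / c₀ * (a₀ - c₀))
  linarith

theorem abs_div_sub_div_le_mul {p p₀ q q₀ ε : ℝ} (hε : 0 < ε) (hε1 : ε ≤ 1) (hp : 0 < p)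
    (hp₀ : 0 < p₀) (h1 : (1 - ε / 4) * p ≤ q) (h2 : q ≤ p) (h3 : (1 - ε / 4) * p₀ ≤ q₀)
    (h4 : q₀ ≤ p₀) : |p / p₀ - q / q₀| ≤ ε * (p / p₀) := by
  have hq₀ : 0 < q₀ := lt_of_lt_of_le (mul_pos (by linarith) hp₀) h3
  have hpp : 0 < p * p₀ := mul_pos hp hp₀
  have e1 : p / p₀ - q / q₀ = (p * q₀ - q * p₀) / (p₀ * q₀) := by
    field_simp
  have e2 : ε * (p / p₀) = (ε * (p * q₀)) / (p₀ * q₀) := by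
    field_simp
  rw [e1, e2, abs_div, abs_of_pos (mul_pos hp₀ hq₀)]
  gcongr
  have a1 : (1 - ε / 4) * (p * p₀) ≤ p * q₀ := by
    have := mul_le_mul_of_nonneg_left h3 hp.le
    linarith
  have a2 : p * q₀ ≤ p * p₀ := mul_le_mul_of_nonneg_left h4 hp.le
  have a3 : (1 - ε / 4) * (p * p₀) ≤ q * p₀ := by
    have := mul_le_mul_of_nonneg_right h1 hp₀.le
    linarith
  have a4 : q * p₀ ≤ p * p₀ := mul_le_mul_of_nonneg_right h2 hp₀.le
  have a5 : ε * ((1 - ε / 4) * (p * p₀)) ≤ ε * (p * q₀) := mul_le_mul_of_nonneg_left a1 hε.le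
  have a6 : 0 ≤ ε * (p * p₀) * (1 - ε) := mul_nonneg (mul_nonneg hε.le hpp.le) (by linarith)
  rw [abs_le]
  constructor <;> nlinarith

theorem abs_sum_ratio_sub_le {L L' : ℕ} (hL : L ≤ n) (hLL' : L ≤ L') (hL' : L' ≤ n)
    {p q : Fin n → ℝ} {p₀ q₀ ε x y : ℝ}
    (hhead : ∀ i : Fin n, (i : ℕ) < L → |p i / p₀ - q i / q₀| ≤ ε * (p i / p₀))
    (hq : ∀ i, 0 ≤ q i / q₀)
    (hmid : ∀ i : Fin n, L ≤ (i : ℕ) → (i : ℕ) < L' → q i / q₀ ≤ x)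
    (htail : ∀ i : Fin n, L' ≤ (i : ℕ) → q i / q₀ ≤ y) :
    |(∑ i, headInd L i * p i) / p₀ - (∑ i, q i) / q₀|
      ≤ ε * ((∑ i, headInd L i * p i) / p₀) + ((L' : ℝ) - L) * x + ((n : ℝ) - L') * y := by
  have e1 : (∑ i, headInd L i * p i) / p₀ - (∑ i, q i) / q₀
      = ∑ i, (headInd L i * (p i / p₀) - q i / q₀) := by
    rw [Finset.sum_sub_distrib, Finset.sum_div, Finset.sum_div]
    simp only [mul_div_assoc]
  have e2 : ε * ((∑ i, headInd L i * p i) / p₀) + ((L' : ℝ) - L) * x + ((n : ℝ) - L') * y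
      = ∑ i : Fin n, (ε * (headInd L i * (p i / p₀)) + (headInd L' i - headInd L i) * x
          + (1 - headInd L' i) * y) := by
    rw [Finset.sum_add_distrib, Finset.sum_add_distrib, ← Finset.mul_sum, ← Finset.sum_mul,
      ← Finset.sum_mul, Finset.sum_sub_distrib, Finset.sum_sub_distrib, sum_headInd hL,
      sum_headInd hL', Finset.sum_div]
    simp [mul_div_assoc]
  rw [e1, e2]
  refine (Finset.abs_sum_le_sum_abs _ _).trans (Finset.sum_le_sum fun i _ => ?_)
  rcases lt_or_ge (i : ℕ) L with h | h
  · rw [headInd_of_lt h, headInd_of_lt (h.trans_le hLL')]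
    simpa using hhead i h
  · rw [headInd_of_le h]
    rcases lt_or_ge (i : ℕ) L' with h' | h'
    · rw [headInd_of_lt h']
      simpa [abs_of_nonneg (hq i)] using hmid i h h'
    · rw [headInd_of_le h']
      simpa [abs_of_nonneg (hq i)] using htail i h'

end Ratios

/-! ### The index `L'` -/

section LPrime

variable {n N L : ℕ} {lam : ℕ → ℝ} {ε' α : ℝ}

theorem Lprime_mem (hL1 : 1 ≤ L) (hLn : L ≤ n) (h : α ^ N < ε' * lam L) :
    L ≤ Lprime n N lam ε' α ∧ Lprime n N lam ε' α ≤ n ∧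
      α ^ N < ε' * lam (Lprime n N lam ε' α) := by
  have hbdd : BddAbove {l : ℕ | (1 ≤ l ∧ l ≤ n) ∧ α ^ N < ε' * lam l} := ⟨n, fun l hl => hl.1.2⟩
  have hmem : L ∈ {l : ℕ | (1 ≤ l ∧ l ≤ n) ∧ α ^ N < ε' * lam l} := ⟨⟨hL1, hLn⟩, h⟩
  have h2 := Nat.sSup_mem ⟨L, hmem⟩ hbdd
  exact ⟨le_csSup hbdd hmem, h2.1.2, h2.2⟩

theorem le_of_Lprime_lt {l : ℕ} (hl1 : 1 ≤ l) (hln : l ≤ n) (h : Lprime n N lam ε' α < l) :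
    ε' * lam l ≤ α ^ N := by
  by_contra! hcon
  have hbdd : BddAbove {l : ℕ | (1 ≤ l ∧ l ≤ n) ∧ α ^ N < ε' * lam l} := ⟨n, fun l hl => hl.1.2⟩
  exact absurd (le_csSup hbdd ⟨⟨hl1, hln⟩, hcon⟩) (not_le.2 h)

end LPrime

/-! ### The eigengap -/

theorem eigengap_le {n : ℕ} {A : Matrix (Fin n) (Fin n) ℝ} (hA : A.IsHermitian) {i j : Fin n}
    (h : i ≠ j) : eigengap hA ≤ |eig hA (i + 1) - eig hA (j + 1)| := by
  refine csInf_le ⟨0, ?_⟩ ⟨i + 1, j + 1, ⟨by omega, i.2⟩, ⟨by omega, j.2⟩, ?_, rfl⟩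
  · rintro _ ⟨i, j, _, _, _, rfl⟩
    exact abs_nonneg _
  · intro h'
    exact h (Fin.ext (by omega))

/-- For `n ≤ 1` the infimum runs over the empty set and is `0` by convention. -/
theorem two_le_of_eigengap_pos {n : ℕ} {A : Matrix (Fin n) (Fin n) ℝ} (hA : A.IsHermitian)
    (h : 0 < eigengap hA) : 2 ≤ n := by
  by_contra! hn
  have : {x : ℝ | ∃ i j : ℕ, (1 ≤ i ∧ i ≤ n) ∧ (1 ≤ j ∧ j ≤ n) ∧ i ≠ j ∧
      x = |eig hA i - eig hA j|} = ∅ := by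
    refine Set.eq_empty_iff_forall_notMem.2 ?_
    rintro x ⟨i, j, hi, hj, hij, _⟩
    omega
  rw [eigengap, this, Real.sInf_empty] at h
  exact lt_irrefl 0 h

/-! ### Assembly of the two bounds -/

set_option maxHeartbeats 1000000 in
theorem theorem5p3
    -- sizes: dimension, depth, target rank
    (n N L : ℕ) (hN : 2 ≤ N) (hL1 : 1 ≤ L) (hLn : L ≤ n)
    -- ground truth with nonnegative, pairwise distinct eigenvalues, and symmetric noise
    (What E : Matrix (Fin n) (Fin n) ℝ) (hW : What.PosSemidef) (hE : E.IsHermitian)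
    (hgap : 0 < eigengap hW.isHermitian)
    -- `lamP i` is the positive part of the `i`-th eigenvalue of the noisy target `What + E`
    (lamP : ℕ → ℝ) (hlamP : ∀ i, lamP i = max (eig (hW.isHermitian.add hE) i) 0)
    (hlamL : 0 < lamP L)
    -- accuracies, initialization scale and step size
    (ε ε' α η : ℝ) (hε : 0 < ε ∧ ε < 1) (hε' : 0 < ε' ∧ ε' < cN N)
    (hα : 0 < α) (hαL : α ^ N < ε' * lamP L)
    (hη : 0 < η)
    (hη' : η < 1 / ((3 * (N : ℝ) - 2) *
      max (α ^ (N - 2)) (specNorm (What + E) ^ (2 - 2 / (N : ℝ)))))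
    -- `Wplus` is a symmetric matrix with the eigenvalues `lamP i`
    (Wplus : Matrix (Fin n) (Fin n) ℝ) (hWplus : Wplus.IsHermitian)
    (hWplus' : ∀ i, eig hWplus i = lamP i)
    -- an iteration in the time window; the right end is defined only if `α ^ N < lamP (L + 1)`
    (k : ℕ) (hk0 : Tzero N L lamP ε α η ≤ k)
    (hk1 : α ^ N < lamP (L + 1) → (k : ℝ) ≤ Tone N (lamP (L + 1)) ε' α η)
    -- best rank-`L` approximations
    (WhatL WplusL WkL : Matrix (Fin n) (Fin n) ℝ)
    (hWhatL : IsBestRankApprox L What WhatL)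
    (hWplusL : IsBestRankApprox L Wplus WplusL)
    (hWkL : IsBestRankApprox L (gdProd N (What + E) η α k) WkL) :
    |effRank WhatL - effRank (gdProd N (What + E) η α k)|
        ≤ 2 * L * (specNorm E / eig hW.isHermitian 1) + ε * effRank WplusL
          + 2 * ((Lprime n N lamP ε' α : ℝ) - L) / cN N * (lamP (L + 1) / lamP 1) * ε'
          + ((n : ℝ) - Lprime n N lamP ε' α) * (2 * α ^ N / (ε' * lamP 1))
    ∧ frobNorm (WkL - WhatL)
        < (4 * Real.sqrt (2 * L) / eigengap hW.isHermitian * eig hW.isHermitian 1 + Real.sqrt L)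
            * specNorm E
          + ε * Real.sqrt L * (eig hW.isHermitian 1 + specNorm E) / 4 := by
  have hn2 : 2 ≤ n := two_le_of_eigengap_pos _ hgap
  have hN0 : N ≠ 0 := by omega
  have hNR : (2 : ℝ) ≤ N := by exact_mod_cast hN
  have hc := cN_mem hN
  obtain ⟨hε0, hε1⟩ := hε
  obtain ⟨hε'0, hε'c⟩ := hε'
  have hαN : 0 < α ^ N := pow_pos hα N
  set i₀ : Fin n := ⟨0, by omega⟩ with hi₀
  -- Indices in `Fin n` start at `0` and those of `eig` at `1`, so `l` carries the `L`-th
  -- eigenvalue.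
  set l : Fin n := ⟨L - 1, by omega⟩ with hl
  have hlL : (l : ℕ) + 1 = L := by simp only [hl]; omega
  have hi₀le : ∀ i : Fin n, i₀ ≤ i := fun i => Fin.le_def.2 (Nat.zero_le _)
  -- the spectral data
  set A' := What + E with hA'
  have hH' : A'.IsHermitian := hW.isHermitian.add hE
  set μ : Fin n → ℝ := fun i => eig hW.isHermitian (i + 1) with hμ
  set τ : Fin n → ℝ := fun i => eig hH' (i + 1) with hτ
  set p : Fin n → ℝ := fun i => lamP (i + 1) with hp
  have hpτ : ∀ i, p i = max (τ i) 0 := fun i => hlamP _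
  obtain ⟨b, hb⟩ := exists_eig_basis hW.isHermitian
  obtain ⟨b', hb'⟩ := exists_eig_basis hH'
  obtain ⟨b'', hb''⟩ := exists_eig_basis hWplus
  simp only [hWplus'] at hb''
  have hμa : Antitone μ := eig_antitone _
  have hτa : Antitone τ := eig_antitone _
  have hpa : Antitone p := fun i j hij => by
    rw [hpτ, hpτ]
    exact max_le_max_right 0 (hτa hij)
  have hp0 : ∀ i, 0 ≤ p i := fun i => by rw [hpτ]; exact le_max_right _ _
  have hpl : p l = lamP L := by simp only [hp, hlL]
  have hpi₀ : p i₀ = lamP 1 := by simp only [hp, hi₀, zero_add]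
  have hμi₀ : μ i₀ = eig hW.isHermitian 1 := by simp only [hμ, hi₀, zero_add]
  rw [← hpl] at hlamL hαL
  have hpos : ∀ i : Fin n, (i : ℕ) < L → p l ≤ p i := fun i hi => hpa (by rw [Fin.le_def]; omega)
  have hτp : ∀ i : Fin n, (i : ℕ) < L → τ i = p i := by
    intro i hi
    have := hlamL.trans_le (hpos i hi)
    rw [hpτ] at this ⊢
    exact (max_eq_left (by_contra fun h => by rw [max_eq_right (by linarith)] at this; linarith)).symm
  have hp₀ : 0 < p i₀ := hlamL.trans_le (hpa (hi₀le l))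
  have hμ0 : ∀ i, 0 ≤ μ i := by
    intro i
    have h1 := hb i
    have h2 : inner ℝ (b i) (toEuclideanLin What (b i)) = μ i := by
      rw [h1, inner_smul_right, b.inner_eq_one, mul_one]
    rw [← h2]
    have h3 := hW.dotProduct_mulVec_nonneg (WithLp.ofLp (b i))
    simpa [PiLp.inner_apply, toLpLin_apply, dotProduct, mul_comm] using h3
  have hgap' : ∀ i j : Fin n, i < j → eigengap hW.isHermitian ≤ μ i - μ j := by
    intro i j hij
    have h1 := eigengap_le hW.isHermitian hij.ne
    rwa [abs_of_nonneg (sub_nonneg.2 (hμa hij.le))] at h1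
  have hμ₀ : 0 < μ i₀ := by
    have h1 := hgap' i₀ ⟨1, by omega⟩ (by simp [Fin.lt_def, hi₀])
    linarith [hμ0 ⟨1, by omega⟩]
  have hspecW : specNorm What = μ i₀ := le_antisymm
    (hb.specNorm_le (hμ0 i₀) fun i => by rw [abs_of_nonneg (hμ0 i)]; exact hμa (hi₀le i))
    ((le_abs_self _).trans (hb.abs_le_specNorm i₀))
  have hEsub : A' - What = E := by rw [hA', add_sub_cancel_left]
  have hweyl : ∀ i, |τ i - μ i| ≤ specNorm E := fun i => by
    have := hb.abs_sub_le hb' hμa hτa i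
    rwa [hEsub] at this
  -- the step size
  set S := specNorm A' with hS
  have hτS : ∀ i, |τ i| ≤ S := hb'.abs_le_specNorm
  have hpS : ∀ i, p i ≤ S := fun i => by
    rw [hpτ]
    exact max_le ((le_abs_self _).trans (hτS i)) (specNorm_nonneg _)
  have hS0 : 0 < S := hp₀.trans_le (hpS i₀)
  -- With `β ^ N` the spectral norm of the noisy target, `|τ i| ≤ β ^ N` for all `i`, and the
  -- step-size hypothesis becomes the condition of `gdStep_mono`.
  set β := S ^ (1 / (N : ℝ)) with hβ
  have hβ0 : 0 < β := Real.rpow_pos_of_pos hS0 _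
  have hβN : β ^ N = S := rpow_one_div_pow hN0 hS0.le
  have hβp : S ^ (2 - 2 / (N : ℝ)) = β ^ (2 * N - 2) := by
    rw [hβ, ← Real.rpow_mul_natCast hS0.le]
    congr 1
    rw [Nat.cast_sub (by omega)]
    push_cast
    field_simp
  have hαβ : α ≤ β := by
    refine (pow_le_pow_iff_left₀ hα.le hβ0.le hN0).1 ?_
    rw [hβN]
    have := hpS l
    nlinarith
  have hstep : η * (3 * N - 2) * β ^ (2 * N - 2) ≤ 1 := by
    rw [hβp] at hη'
    have h3 : (0 : ℝ) < 3 * N - 2 := by linarith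
    have h4 : β ^ (2 * N - 2) ≤ max (α ^ (N - 2)) (β ^ (2 * N - 2)) := le_max_right _ _
    have h5 : 0 < max (α ^ (N - 2)) (β ^ (2 * N - 2)) := (pow_pos hβ0 _).trans_le h4
    rw [lt_div_iff₀ (by positivity), ← mul_assoc] at hη'
    exact (mul_le_mul_of_nonneg_left h4 (by positivity)).trans hη'.le
  have hlb : ∀ i, -β ^ N ≤ τ i := fun i => by rw [hβN]; exact (abs_le.1 (hτS i)).1
  have hub : ∀ i, τ i ≤ β ^ N := fun i => by rw [hβN]; exact (abs_le.1 (hτS i)).2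
  -- the diagonal of the iterate
  set q : Fin n → ℝ := fun i => gdScalar N η (τ i) α k ^ N with hq
  have hWk : IsDiagIn b' q (gdProd N A' η α k) := isDiagIn_gdProd hb' η α k
  have hd0 : ∀ i, 0 ≤ gdScalar N η (τ i) α k := fun i =>
    (gdScalar_mem hN hη.le hstep (hlb i) (hub i) le_rfl hα.le hαβ k).1
  have hq0 : ∀ i, 0 ≤ q i := fun i => pow_nonneg (hd0 i) N
  have hqa : Antitone q := fun i j hij => pow_le_pow_left₀ (hd0 j)
    (gdScalar_mono_left hN hη.le hstep (hτa hij) (hlb j) (hub i) hα.le hαβ k) N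
  have hqhead : ∀ i : Fin n, (i : ℕ) < L → (1 - ε / 4) * p i < q i ∧ q i ≤ p i := by
    intro i hi
    have hpi := hpos i hi
    have hT : TId N (p i) ((p i) ^ (1 / (N : ℝ)) / (4 * N) * ε) α η ≤ k := by
      refine le_trans ?_ ((le_max_right _ _).trans hk0)
      refine le_csSup ((Set.finite_Icc 1 L).image _).bddAbove
        ⟨(i : ℕ) + 1, ⟨by omega, by omega⟩, rfl⟩
    have hατ : α ^ N < cN N * p i := by
      have h1 : ε' * p l ≤ cN N * p l := mul_le_mul_of_nonneg_right hε'c.le hlamL.le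
      have h2 : cN N * p l ≤ cN N * p i := mul_le_mul_of_nonneg_left hpi hc.1.le
      linarith
    have h := gdScalar_pow_mem_of_TId_le hN hη hstep hα hβ0.le (hlamL.trans_le hpi)
      ((hpS i).trans_eq hβN.symm) hατ hε0 hε1.le hT
    simp only [hq, hτp i hi]
    exact h
  have hqtail : ∀ i : Fin n, L ≤ (i : ℕ) → q i ≤ max (α ^ N) (ε' * lamP (L + 1)) := by
    intro i hi
    have hLn' : L < n := hi.trans_lt i.2
    have e : lamP (L + 1) = p ⟨L, hLn'⟩ := rfl
    refine gdScalar_pow_le_of_window hN hη hstep hα hαβ (hlb i) ?_ ?_ hε'0 hε'c hk1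
    · rw [e]
      refine le_trans ?_ (hpa (show (⟨L, hLn'⟩ : Fin n) ≤ i from hi))
      rw [hpτ]
      exact le_max_left _ _
    · rw [e, hβN]
      exact hpS _
  -- This bound for indices beyond `L'` holds at every step: the iterate stays below `max (α ^ N) (τ
  -- i)`, and both are at most `α ^ N / ε'`.
  have hqtail' : ∀ i : Fin n, ε' * p i ≤ α ^ N → q i ≤ α ^ N / ε' := by
    intro i hi
    refine (gdScalar_pow_le_max hN hη hstep hα hαβ (hlb i) (hub i)).trans (max_le ?_ ?_)
    · rw [le_div_iff₀ hε'0]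
      nlinarith
    · rw [le_div_iff₀ hε'0]
      have : τ i ≤ p i := by rw [hpτ]; exact le_max_left _ _
      nlinarith
  -- Trailing values are at most `ε' * p l ≤ p l / 2`, while `q l > (1 - ε / 4) * p l`. This gap
  -- determines the best approximation of the iterate uniquely.
  have hqgap : ∀ i : Fin n, L ≤ (i : ℕ) → q i < q l := by
    intro i hi
    have hLn' : L < n := hi.trans_lt i.2
    have h1 : lamP (L + 1) ≤ p l :=
      hpa (show l ≤ (⟨L, hLn'⟩ : Fin n) from Fin.le_def.2 (by simp only [hl]; omega))
    have h2 := hqtail i hi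
    have h3 := (hqhead l (by omega)).1
    have h4 : max (α ^ N) (ε' * lamP (L + 1)) ≤ ε' * p l :=
      max_le hαL.le (mul_le_mul_of_nonneg_left h1 hε'0.le)
    have h5 : ε' * p l ≤ 1 / 2 * p l := mul_le_mul_of_nonneg_right (by linarith) hlamL.le
    have h6 : 1 / 2 * p l ≤ (1 - ε / 4) * p l :=
      mul_le_mul_of_nonneg_right (by linarith) hlamL.le
    linarith
  have hq₀ : (1 - ε / 4) * p i₀ < q i₀ ∧ q i₀ ≤ p i₀ := hqhead i₀ (by simp only [hi₀]; omega)
  have hq₀2 : p i₀ / 2 ≤ q i₀ := by nlinarith [hq₀.1]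
  have hq₀pos : 0 < q i₀ := by linarith
  -- the best approximations
  have hWhatLd : IsDiagIn b (fun i => headInd L i * μ i) WhatL :=
    hWhatL.isDiagIn hLn hb hμa hμ0 l hlL fun i hi => by
      have := hgap' l i (by rw [Fin.lt_def]; omega)
      linarith
  have hWkLd : IsDiagIn b' (fun i => headInd L i * q i) WkL :=
    hWkL.isDiagIn hLn hWk hqa hq0 l hlL hqgap
  have hind₀ : headInd L i₀ = 1 := headInd_of_lt (by simp only [hi₀]; omega)
  constructor
  · have hr1 : effRank WhatL = (∑ i, headInd L i * μ i) / μ i₀ := by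
      have h := hWhatLd.effRank (fun i => mul_nonneg (headInd_nonneg i) (hμ0 i)) i₀ fun i => by
        rw [hind₀, one_mul]
        exact (mul_le_of_le_one_left (hμ0 i) (headInd_le_one i)).trans (hμa (hi₀le i))
      rw [h, hind₀, one_mul]
    have hr2 : effRank (gdProd N A' η α k) = (∑ i, q i) / q i₀ :=
      hWk.effRank hq0 i₀ fun i => hqa (hi₀le i)
    have hr3 := hWplusL.le_effRank hLn hb'' hpa hp0 l hlL hlamL i₀ fun i => hpa (hi₀le i)
    have hpμ : ∀ i, |μ i - p i| ≤ specNorm E := by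
      intro i
      refine le_trans ?_ (hweyl i)
      rw [hpτ, abs_sub_comm, ← max_eq_left (hμ0 i)]
      simpa [max_eq_left (hμ0 i)] using abs_max_sub_max_le_abs (τ i) (μ i) 0
    have hfirst : |(∑ i, headInd L i * μ i) / μ i₀ - (∑ i, headInd L i * p i) / p i₀|
        ≤ 2 * L * (specNorm E / μ i₀) := by
      have e1 : (∑ i, headInd L i * μ i) / μ i₀ - (∑ i, headInd L i * p i) / p i₀
          = ∑ i, headInd L i * (μ i / μ i₀ - p i / p i₀) := by
        rw [Finset.sum_div, Finset.sum_div, ← Finset.sum_sub_distrib]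
        exact Finset.sum_congr rfl fun i _ => by ring
      have e2 : 2 * L * (specNorm E / μ i₀)
          = ∑ i : Fin n, headInd L i * (2 * (specNorm E / μ i₀)) := by
        rw [← Finset.sum_mul, sum_headInd hLn]
        ring
      rw [e1, e2]
      refine (Finset.abs_sum_le_sum_abs _ _).trans (Finset.sum_le_sum fun i _ => ?_)
      rw [abs_mul, abs_of_nonneg (headInd_nonneg i)]
      exact mul_le_mul_of_nonneg_left (abs_div_sub_div_le hμ₀ hp₀ (hp0 i) (hpa (hi₀le i))
        (hpμ i) (hpμ i₀)) (headInd_nonneg i)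
    obtain ⟨hL'1, hL'2, hL'3⟩ := Lprime_mem (N := N) (lam := lamP) (α := α) (ε' := ε') hL1 hLn
      (by rw [← hpl]; exact hαL)
    set L' := Lprime n N lamP ε' α with hL'
    -- The factor `2` in the last two error terms comes from `q i₀ ≥ p i₀ / 2`.
    have hdiv : ∀ i c, q i ≤ c → q i / q i₀ ≤ 2 * c / p i₀ := by
      intro i c hi
      rw [div_le_div_iff₀ hq₀pos hp₀]
      have h1 : q i * p i₀ ≤ c * (2 * q i₀) :=
        mul_le_mul hi (by linarith) hp₀.le ((hq0 i).trans hi)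
      linarith
    have hsecond := abs_sum_ratio_sub_le (p := p) (q := q) (p₀ := p i₀) (q₀ := q i₀) (ε := ε)
      (x := 2 / cN N * (lamP (L + 1) / p i₀) * ε') (y := 2 * α ^ N / (ε' * p i₀))
      hLn hL'1 hL'2
      (fun i hi => abs_div_sub_div_le_mul hε0 hε1.le (hlamL.trans_le (hpos i hi)) hp₀
        (hqhead i hi).1.le (hqhead i hi).2 hq₀.1.le hq₀.2)
      (fun i => div_nonneg (hq0 i) hq₀pos.le)
      (fun i hi hi' => by
        have hLn' : L < n := hi.trans_lt i.2
        have e : lamP (L + 1) = p ⟨L, hLn'⟩ := rfl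
        have h0 : lamP L' ≤ lamP (L + 1) := by
          have := hpa (show (⟨L, hLn'⟩ : Fin n) ≤ ⟨L' - 1, by omega⟩ from
            Fin.le_def.2 (by simp only; omega))
          simp only [hp] at this
          rwa [Nat.sub_add_cancel (by omega)] at this
        have h1 : α ^ N ≤ ε' * lamP (L + 1) :=
          hL'3.le.trans (mul_le_mul_of_nonneg_left h0 hε'0.le)
        have h2 := hqtail i hi
        rw [max_eq_right h1] at h2
        refine (hdiv i _ h2).trans ?_
        have h3 : 0 ≤ lamP (L + 1) / p i₀ := by rw [e]; exact div_nonneg (hp0 _) hp₀.le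
        have h4 : 2 ≤ 2 / cN N := by
          rw [le_div_iff₀ hc.1]
          linarith
        calc 2 * (ε' * lamP (L + 1)) / p i₀ = 2 * (lamP (L + 1) / p i₀) * ε' := by ring
          _ ≤ _ := by gcongr)
      (fun i hi => by
        have h1 := le_of_Lprime_lt (n := n) (N := N) (lam := lamP) (ε' := ε') (α := α)
          (l := (i : ℕ) + 1) (by omega) i.2 (by rw [← hL']; omega)
        refine (hdiv i _ (hqtail' i h1)).trans_eq ?_
        field_simp)
    rw [hr1, hr2, ← hpi₀, ← hμi₀]
    refine (abs_sub_le _ ((∑ i, headInd L i * p i) / p i₀) _).trans ?_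
    have h1 := mul_le_mul_of_nonneg_left hr3 hε0.le
    have e : 2 * ((L' : ℝ) - L) / cN N * (lamP (L + 1) / p i₀) * ε'
        = ((L' : ℝ) - L) * (2 / cN N * (lamP (L + 1) / p i₀) * ε') := by ring
    rw [e]
    linarith
  · have hLpos : (0 : ℝ) < L := by exact_mod_cast hL1
    have hτ₀ : τ i₀ = p i₀ := hτp i₀ (by simp only [hi₀]; omega)
    -- Both matrices are diagonal in `b'` and supported on the first `L` indices, each contributing
    -- an error below `ε / 4 * p i₀`. As `L ≥ 1`, strictness survives summation.
    have hA1 : frobNorm (WkL - diagMat b' fun i => headInd L i * τ i)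
        < ε / 4 * p i₀ * Real.sqrt L := by
      refine lt_of_pow_lt_pow_left₀ 2 (by positivity) ?_
      rw [(hWkLd.sub (isDiagIn_diagMat b' _)).frobNorm_sq, mul_pow, Real.sq_sqrt hLpos.le]
      have e : (ε / 4 * p i₀) ^ 2 * L = ∑ i : Fin n, headInd L i * (ε / 4 * p i₀) ^ 2 := by
        rw [← Finset.sum_mul, sum_headInd hLn, mul_comm]
      rw [e]
      have hterm : ∀ i : Fin n, (i : ℕ) < L → (q i - τ i) ^ 2 < (ε / 4 * p i₀) ^ 2 := by
        intro i hi
        rw [hτp i hi]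
        have h1 := hqhead i hi
        have h2 : ε / 4 * p i ≤ ε / 4 * p i₀ := by
          have := hpa (hi₀le i)
          gcongr
        exact sq_lt_sq' (by linarith) (by nlinarith)
      refine Finset.sum_lt_sum (fun i _ => ?_) ⟨l, Finset.mem_univ l, ?_⟩
      · by_cases hi : (i : ℕ) < L
        · rw [headInd_of_lt hi, one_mul, one_mul, one_mul]
          exact (hterm i hi).le
        · rw [headInd_of_le (by omega)]
          simp
      · rw [headInd_of_lt (by omega), one_mul, one_mul, one_mul]
        exact hterm l (by omega)
    have hA2 := frobNorm_truncation_sub_le hLn hb hb' hμa hτa hgap fun i j hi hj =>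
      hgap' i j (Fin.lt_def.2 (hi.trans_le hj))
    rw [hEsub, hspecW, ← hWhatLd.eq (isDiagIn_diagMat b _)] at hA2
    have hA3 := frobNorm_add_le (WkL - diagMat b' fun i => headInd L i * τ i)
      ((diagMat b' fun i => headInd L i * τ i) - WhatL)
    rw [sub_add_sub_cancel] at hA3
    rw [← hμi₀]
    have hA4 : p i₀ ≤ μ i₀ + specNorm E := by
      rw [← hτ₀]
      linarith [(abs_le.1 (hweyl i₀)).2]
    have hA5 : ε / 4 * p i₀ * Real.sqrt L ≤ ε * Real.sqrt L * (μ i₀ + specNorm E) / 4 := by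
      have : ε / 4 * Real.sqrt L * p i₀ ≤ ε / 4 * Real.sqrt L * (μ i₀ + specNorm E) :=
        mul_le_mul_of_nonneg_left hA4 (by positivity)
      linarith
    have hA6 : (2 * Real.sqrt (2 * L) / eigengap hW.isHermitian * μ i₀ + Real.sqrt L) * specNorm E
        ≤ (4 * Real.sqrt (2 * L) / eigengap hW.isHermitian * μ i₀ + Real.sqrt L)
          * specNorm E := by
      have := specNorm_nonneg E
      gcongr
      norm_num
    linarith
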